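/- Let $K$ be a number field with algebraic closure $\overline K$ and $G_K=\mathrm{Gal}(\overline K/K)$. Let $V$ be a finite-dimensional $\mathbb Q$-vector space with a pure Hodge structure of odd weight $n$, polarized by $\psi: V\otimes V\to\mathbb Q(-n)$; that is, $\psi$ is a nondegenerate $(-1)^n$-symmetric morphism of Hodge structures with $i^{p-q}\psi_{\mathbb C}(x,\bar x)>0$ for $0\ne x\in V^{p,q}$. Let $\mathrm{GIso}_{(V,\psi)}\subset \mathrm{GL}_V$ be the group of similitudes of $\psi$ and $\mathrm{Iso}_{(V,\psi)}$ the group of isometries. Let $D\subset\mathrm{End}_{\mathbb Q}(V)$ be a $\mathbb Q$-subalgebra with $D\,V^{p,q}\subset V^{p,q}$ for all $p,q$, endowed with a continuous action $\rho_e:G_K\to\mathrm{Aut}(D)$ by $\mathbb Q$-algebra automorphisms ($D$ being discrete). For every prime $l$ put $V_l=V\otimes\mathbb Q_l$, $\psi_l=\psi\otimes\mathbb Q_l$, and let $\rho_l: G_K\to \mathrm{GL}(V_l)$ be a continuous representation such that $$\psi_l(\rho_l(\sigma)v,\rho_l(\sigma)w)=\chi_c(\sigma)^{-n}\,\psi_l(v,w),\qquad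 \rho_l(\sigma)(\beta v)=\rho_e(\sigma)(\beta)\,\rho_l(\sigma)(v)$$ for all $\sigma\in G_K$, $v,w\in V_l$, $\beta\in D$, where $\chi_c:G_K\to\mathbb Z_l^\times$ is the $l$-adic cyclotomic character. Define the following algebraic groups, where $G^\circ$ denotes the identity component of $G$: * $\mathrm{MT}(V,\psi)$ is the smallest algebraic subgroup of $\mathrm{GIso}_{(V,\psi)}$ over $\mathbb Q$ whose complex points contain $\mu_\infty(\mathbb C^\times)$, where $\mu_\infty(z)$ acts on $V^{p,q}$ as $z^{-p}$; and $\mathrm H(V,\psi)=(\mathrm{MT}(V,\psi)\cap \mathrm{Iso}_{(V,\psi)})^\circ$ is the Hodge group. * $\mathrm L(V,\psi,D)$ is the identity component of the centralizer of $D$ in $\mathrm{Iso}_{(V,\psi)}$. * $\mathrm{DL}_K(V,\psi,D)$ is the union over $\tau\in G_K/\ker\rho_e$ of the closed subschemes $\{g\in\mathrm{Iso}_{(V,\psi)} : g\beta g^{-1}=\rho_e(\tau)(\beta)\ \ \forall \beta\in D\}$. * $G^{\mathrm{alg}}_{l,K}$ is the Zariski closure of $\rho_l(G_K)$ in $\mathrm{GIso}_{(V_l,\psi_l)}$,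 and $G^{\mathrm{alg}}_{l,K,1}=G^{\mathrm{alg}}_{l,K}\cap \mathrm{Iso}_{(V_l,\psi_l)}$. Assume that for every prime $l$ $$G^{\mathrm{alg}}_{l,K,1}=\mathrm{DL}_K(V,\psi,D)_{\mathbb Q_l}\qquad\text{and}\qquad (G^{\mathrm{alg}}_{l,K})^\circ\subset \mathrm{MT}(V,\psi)_{\mathbb Q_l}$$ (the first condition says that $\mathrm{DL}_K(V,\psi,D)$ serves as the algebraic Sato–Tate group $\mathrm{AST}_K(V,\psi)$). Then: 1. $\mathrm H(V,\psi)=\mathrm L(V,\psi,D)$; 2. the Mumford–Tate conjecture holds: $(G^{\mathrm{alg}}_{l,K})^\circ=\mathrm{MT}(V,\psi)_{\mathbb Q_l}$ for every prime $l$. -/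

import Mathlib

open scoped TensorProduct

noncomputable section

namespace HodgeLadic

/-! ### Linear algebraic groups inside `GL_V`

`V` is a finite-dimensional rational vector space. In characteristic zero every algebraic group is
reduced, so an algebraic subgroup of `GL_V` over a field `k` is identified with the group of its
points over an algebraically closed field `Ω` containing `k`: a subgroup of `GL(Ω ⊗ V)` cut out by
polynomials with coefficients in `k`. Here `Ω` is `ℂ` for `k = ℚ`, and an algebraic closure of
`ℚ_l` for `k = ℚ_l`. -/

/-- The group `GL(R ⊗ V)` of `R`-points of `GL_V`. -/
abbrev GLPoints (R : Type*) [CommRing R] [Algebra ℚ R]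
    (V : Type*) [AddCommGroup V] [Module ℚ V] : Type _ :=
  LinearMap.GeneralLinearGroup R (R ⊗[ℚ] V)

/-- Polynomials over `k` in the matrix entries with respect to a basis of `V`. -/
abbrev EntryPoly (k : Type*) [CommRing k]
    (V : Type*) [AddCommGroup V] [Module ℚ V] : Type _ :=
  MvPolynomial (Fin (Module.finrank ℚ V) × Fin (Module.finrank ℚ V)) k

section Groups

variable {V : Type*} [AddCommGroup V] [Module ℚ V] [FiniteDimensional ℚ V]

/-- The matrix entries of `g ∈ GL(R ⊗ V)` with respect to (the base change of) the chosen basis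
of `V`. -/
def entries {R : Type*} [CommRing R] [Algebra ℚ R] (g : GLPoints R V) :
    Fin (Module.finrank ℚ V) × Fin (Module.finrank ℚ V) → R := fun ij =>
  LinearMap.toMatrix ((Module.finBasis ℚ V).baseChange R) ((Module.finBasis ℚ V).baseChange R)
    (g : Module.End R (R ⊗[ℚ] V)) ij.1 ij.2

/-- The value at `g ∈ GL(R ⊗ V)` of a polynomial in the matrix entries. -/
def evalAt {k : Type*} [CommRing k] {R : Type*} [CommRing R] [Algebra ℚ R] [Algebra k R]
    (f : EntryPoly k V) (g : GLPoints R V) : R :=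
  MvPolynomial.aeval (entries g) f

/-- `X ⊆ GL(R ⊗ V)` is cut out by polynomial equations with coefficients in `k`. -/
def IsAlgebraicOver (k : Type*) [CommRing k] {R : Type*} [CommRing R] [Algebra ℚ R] [Algebra k R]
    (X : Set (GLPoints R V)) : Prop :=
  ∃ S : Set (EntryPoly k V), X = {g | ∀ f ∈ S, evalAt f g = 0}

/-- The `Ω`-points of the Zariski closure over `k` of a set `X` of `R`-points of `GL_V`: the common
zeros in `GL(Ω ⊗ V)` of all polynomials over `k` that vanish on `X`. -/
def zariskiClosure (k : Type*) [CommRing k] {R : Type*} [CommRing R] [Algebra ℚ R] [Algebra k R]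
    (Ω : Type*) [CommRing Ω] [Algebra ℚ Ω] [Algebra k Ω]
    (X : Set (GLPoints R V)) : Set (GLPoints Ω V) :=
  {g | ∀ f : EntryPoly k V, (∀ x ∈ X, evalAt f x = 0) → evalAt f g = 0}

/-- Base change `G ↦ G_{ℚ_l}` of an algebraic subgroup of `GL_V` over `ℚ` (given by its complex
points): the points over the algebraic closure of `ℚ_l` of the zero locus of the ideal of
polynomials over `ℚ` that vanish on `G`. -/
def baseChangePadic (l : ℕ) [Fact l.Prime] (G : Set (GLPoints ℂ V)) :
    Set (GLPoints (AlgebraicClosure ℚ_[l]) V) :=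
  zariskiClosure ℚ (AlgebraicClosure ℚ_[l]) G

/-- The Zariski topology on `GL(Ω ⊗ V)`: the sets `{g | f g ≠ 0}` form a basis of open sets. -/
@[reducible] def zariskiTopology (Ω : Type*) [Field Ω] [Algebra ℚ Ω]
    (V : Type*) [AddCommGroup V] [Module ℚ V] [FiniteDimensional ℚ V] :
    TopologicalSpace (GLPoints Ω V) :=
  TopologicalSpace.generateFrom {U | ∃ f : EntryPoly Ω V, U = {g | evalAt f g ≠ 0}}

/-- The identity component `G°` of an algebraic group `G`: the connected component of `1` in `G`
for the Zariski topology. -/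
def identityComponent {Ω : Type*} [Field Ω] [Algebra ℚ Ω] (G : Set (GLPoints Ω V)) :
    Set (GLPoints Ω V) :=
  @connectedComponentIn _ (zariskiTopology Ω V) G 1

/-- The points over `R` of `GIso_(V, ψ)`. -/
def gIso (R : Type*) [CommRing R] [Algebra ℚ R] (ψ : LinearMap.BilinForm ℚ V) :
    Set (GLPoints R V) :=
  {g | ∃ c : Rˣ, ∀ v w : R ⊗[ℚ] V,
    ψ.baseChange R ((g : Module.End R (R ⊗[ℚ] V)) v) ((g : Module.End R (R ⊗[ℚ] V)) w)
      = (c : R) * ψ.baseChange R v w}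

/-- The points over `R` of `Iso_(V, ψ)`. -/
def iso (R : Type*) [CommRing R] [Algebra ℚ R] (ψ : LinearMap.BilinForm ℚ V) :
    Set (GLPoints R V) :=
  {g | ∀ v w : R ⊗[ℚ] V,
    ψ.baseChange R ((g : Module.End R (R ⊗[ℚ] V)) v) ((g : Module.End R (R ⊗[ℚ] V)) w)
      = ψ.baseChange R v w}

/-- The Lefschetz group `L(V, ψ, D) = C_D(Iso_(V, ψ))°`. -/
def lefschetz (ψ : LinearMap.BilinForm ℚ V) (D : Subalgebra ℚ (Module.End ℚ V)) :
    Set (GLPoints ℂ V) :=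
  identityComponent {g | g ∈ iso ℂ ψ ∧ ∀ β ∈ D,
    (g : Module.End ℂ (ℂ ⊗[ℚ] V)) * LinearMap.baseChange ℂ β
      = LinearMap.baseChange ℂ β * (g : Module.End ℂ (ℂ ⊗[ℚ] V))}

/-- For an action `ρe` of a group `Γ` on `D` and `τ ∈ Γ`, the twist `DL^τ(V, ψ, D)`: those
`g ∈ Iso_(V, ψ)` with `g β g⁻¹ = ρe(τ)(β)` for all `β ∈ D`. -/
def twistedLefschetz {Γ : Type*} [Group Γ] (ψ : LinearMap.BilinForm ℚ V)
    (D : Subalgebra ℚ (Module.End ℚ V)) (ρe : Γ →* (D ≃ₐ[ℚ] D)) (τ : Γ) :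
    Set (GLPoints ℂ V) :=
  {g | g ∈ iso ℂ ψ ∧ ∀ β : D,
    (g : Module.End ℂ (ℂ ⊗[ℚ] V)) * LinearMap.baseChange ℂ (β : Module.End ℚ V) *
        ((g⁻¹ : GLPoints ℂ V) : Module.End ℂ (ℂ ⊗[ℚ] V))
      = LinearMap.baseChange ℂ (ρe τ β : Module.End ℚ V)}

/-- The twisted decomposable Lefschetz group `DL_K(V, ψ, D)`, for `Γ = G_K`. The twist by `τ`
depends only on the class of `τ` in `G_K / ker ρe = Gal(K_e / K)`. -/
def decomposableLefschetz {Γ : Type*} [Group Γ] (ψ : LinearMap.BilinForm ℚ V)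
    (D : Subalgebra ℚ (Module.End ℚ V)) (ρe : Γ →* (D ≃ₐ[ℚ] D)) :
    Set (GLPoints ℂ V) :=
  ⋃ τ : Γ, twistedLefschetz ψ D ρe τ

end Groups

/-! ### Hodge structures, Mumford-Tate and Hodge groups -/

/-- Complex conjugation on `ℂ ⊗ V`. -/
def conjTensor (V : Type*) [AddCommGroup V] [Module ℚ V] : (ℂ ⊗[ℚ] V) →ₗ[ℚ] (ℂ ⊗[ℚ] V) :=
  TensorProduct.map (Complex.conjAe.toLinearMap.restrictScalars ℚ) LinearMap.id

/-- A pure rational Hodge structure of weight `n` on `V`; `comp p` is `V^{p, n - p}`. -/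
structure HodgeStructure (V : Type*) [AddCommGroup V] [Module ℚ V] (n : ℤ) where
  comp : ℤ → Submodule ℂ (ℂ ⊗[ℚ] V)
  isInternal : DirectSum.IsInternal comp
  conj_mem : ∀ p, ∀ x ∈ comp p, conjTensor V x ∈ comp (n - p)

namespace HodgeStructure

variable {V : Type*} [AddCommGroup V] [Module ℚ V] {n : ℤ} (h : HodgeStructure V n)

/-- A polarization of a Hodge structure of weight `n`: a nondegenerate `(-1)^n`-symmetric form
that is a morphism `V ⊗ V → ℚ(-n)` of Hodge structures and satisfies the positivity condition
`i^(p-q) ψ(x, x̄) > 0` for `0 ≠ x ∈ V^{p,q}` (this number is real by symmetry). -/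
structure IsPolarization (ψ : LinearMap.BilinForm ℚ V) : Prop where
  nondegenerate : ψ.Nondegenerate
  symm : ∀ v w, ψ w v = (-1 : ℚ) ^ n * ψ v w
  orthogonal : ∀ p p', p + p' ≠ n → ∀ x ∈ h.comp p, ∀ y ∈ h.comp p', ψ.baseChange ℂ x y = 0
  pos : ∀ p, ∀ x ∈ h.comp p, x ≠ 0 →
    0 < (Complex.I ^ (p - (n - p)) * ψ.baseChange ℂ x (conjTensor V x)).re

/-- `D` preserves the Hodge decomposition. -/
def PreservedBy (D : Subalgebra ℚ (Module.End ℚ V)) : Prop :=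
  ∀ β ∈ D, ∀ p, ∀ x ∈ h.comp p, LinearMap.baseChange ℂ β x ∈ h.comp p

/-- The Hodge decomposition as an isomorphism. -/
def decomposition : (DirectSum ℤ fun p => h.comp p) ≃ₗ[ℂ] (ℂ ⊗[ℚ] V) :=
  LinearEquiv.ofBijective (DirectSum.coeLinearMap h.comp) h.isInternal

/-- The cocharacter `μ_∞`: `μ_∞(z)` is multiplication by `z^(-p)` on `V^{p, n - p}`. -/
def cocharacter (z : ℂˣ) : GLPoints ℂ V :=
  LinearMap.GeneralLinearGroup.ofLinearEquiv
    (h.decomposition.symm ≪≫ₗ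
      DFinsupp.mapRange.linearEquiv (fun p : ℤ => LinearEquiv.smulOfUnit (z ^ (-p))) ≪≫ₗ
      h.decomposition)

theorem cocharacter_apply (z : ℂˣ) (p : ℤ) (x : ℂ ⊗[ℚ] V) (hx : x ∈ h.comp p) :
    (h.cocharacter z : Module.End ℂ (ℂ ⊗[ℚ] V)) x = ((z : ℂ) ^ (-p)) • x := by
  have key : h.decomposition.symm x = DirectSum.lof ℂ ℤ (fun p => h.comp p) p ⟨x, hx⟩ := by
    rw [LinearEquiv.symm_apply_eq]
    exact (DirectSum.coeLinearMap_lof h.comp p ⟨x, hx⟩).symm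
  change h.decomposition (DFinsupp.mapRange.linearEquiv
    (fun p : ℤ => LinearEquiv.smulOfUnit (z ^ (-p))) (h.decomposition.symm x)) = _
  have hs : DFinsupp.mapRange.linearEquiv (fun q : ℤ => LinearEquiv.smulOfUnit (z ^ (-q)))
      (DirectSum.lof ℂ ℤ (fun q => h.comp q) p ⟨x, hx⟩)
      = DirectSum.lof ℂ ℤ (fun q => h.comp q) p ((z ^ (-p)) • ⟨x, hx⟩) :=
    DFinsupp.mapRange_single (hf := fun q => smul_zero (z ^ (-q)))
  rw [key]
  refine (congrArg h.decomposition hs).trans ?_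
  refine (DirectSum.coeLinearMap_lof h.comp p _).trans ?_
  simp [Units.smul_def]

variable [FiniteDimensional ℚ V]

/-- The Mumford-Tate group `MT(V, ψ)`: the smallest algebraic subgroup of `GIso_(V, ψ)` over `ℚ`
whose group of complex points contains the image of `μ_∞`. -/
def mumfordTate (ψ : LinearMap.BilinForm ℚ V) : Subgroup (GLPoints ℂ V) :=
  sInf {M | IsAlgebraicOver ℚ (M : Set (GLPoints ℂ V)) ∧ (M : Set (GLPoints ℂ V)) ⊆ gIso ℂ ψ ∧
    ∀ z : ℂˣ, h.cocharacter z ∈ M}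

/-- The decomposable Hodge group `DH(V, ψ) = MT(V, ψ) ∩ Iso_(V, ψ)`. -/
def decomposableHodgeGroup (ψ : LinearMap.BilinForm ℚ V) : Set (GLPoints ℂ V) :=
  (h.mumfordTate ψ : Set (GLPoints ℂ V)) ∩ iso ℂ ψ

/-- The Hodge group `H(V, ψ) = DH(V, ψ)°`. -/
def hodgeGroup (ψ : LinearMap.BilinForm ℚ V) : Set (GLPoints ℂ V) :=
  identityComponent (h.decomposableHodgeGroup ψ)

end HodgeStructure

/-! ### The `l`-adic side -/

section Ladic

variable {V : Type*} [AddCommGroup V] [Module ℚ V] [FiniteDimensional ℚ V]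
  {l : ℕ} [Fact l.Prime] {Γ : Type*} [Group Γ]

/-- Continuity of an `l`-adic representation on `V_l = ℚ_l ⊗ V`: all matrix entries are
continuous functions. -/
def IsContinuousRep [TopologicalSpace Γ] (ρ : Γ →* GLPoints ℚ_[l] V) : Prop :=
  Continuous fun σ => entries (ρ σ)

/-- `G_{l,K}^alg`: the Zariski closure of the image of `ρ_l`. -/
def algMonodromy (ρ : Γ →* GLPoints ℚ_[l] V) : Set (GLPoints (AlgebraicClosure ℚ_[l]) V) :=
  zariskiClosure ℚ_[l] (AlgebraicClosure ℚ_[l]) (Set.range ρ)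

/-- `G_{l,K,1}^alg = G_{l,K}^alg ∩ Iso_(V_l, ψ_l)`. -/
def algMonodromyOne (ψ : LinearMap.BilinForm ℚ V) (ρ : Γ →* GLPoints ℚ_[l] V) :
    Set (GLPoints (AlgebraicClosure ℚ_[l]) V) :=
  algMonodromy ρ ∩ iso (AlgebraicClosure ℚ_[l]) ψ

/-- The form `ψ_l : V_l × V_l → ℚ_l(-n)` is equivariant for the absolute Galois group of `K`, which
acts on `ℚ_l(-n)` through the `(-n)`-th power of the cyclotomic character. -/
def IsFormEquivariant {K Kbar : Type*} [Field K] [Field Kbar] [Algebra K Kbar]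
    (n : ℤ) (ψ : LinearMap.BilinForm ℚ V) (ρ : Gal(Kbar/K) →* GLPoints ℚ_[l] V) : Prop :=
  ∀ (σ : Gal(Kbar/K)) (v w : ℚ_[l] ⊗[ℚ] V),
    ψ.baseChange ℚ_[l] ((ρ σ : Module.End ℚ_[l] (ℚ_[l] ⊗[ℚ] V)) v)
        ((ρ σ : Module.End ℚ_[l] (ℚ_[l] ⊗[ℚ] V)) w)
      = (((cyclotomicCharacter Kbar l σ.toRingEquiv ^ (-n) : ℤ_[l]ˣ) : ℤ_[l]) : ℚ_[l]) *
          ψ.baseChange ℚ_[l] v w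

/-- The action of `D` on `V_l` is equivariant: `ρ_l(σ)(β v) = σ(β) (ρ_l(σ) v)`. -/
def IsEndEquivariant (D : Subalgebra ℚ (Module.End ℚ V)) (ρe : Γ →* (D ≃ₐ[ℚ] D))
    (ρ : Γ →* GLPoints ℚ_[l] V) : Prop :=
  ∀ (σ : Γ) (β : D) (v : ℚ_[l] ⊗[ℚ] V),
    (ρ σ : Module.End ℚ_[l] (ℚ_[l] ⊗[ℚ] V)) (LinearMap.baseChange ℚ_[l] (β : Module.End ℚ V) v)
      = LinearMap.baseChange ℚ_[l] (ρe σ β : Module.End ℚ V)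
          ((ρ σ : Module.End ℚ_[l] (ℚ_[l] ⊗[ℚ] V)) v)

end Ladic

end HodgeLadic

end

open HodgeLadic

noncomputable section

namespace HodgeLadic

/-! ### Automorphisms of algebraically closed fields and cyclotomic characters -/

/-! Let `C` be the group of isometries of `ψ` commuting with `D`, so that `L = C°`. All comparisons
between `ℂ` and the algebraic closure of `ℚ_l` go through an abstract field isomorphism
(`nonempty_complex_ringEquiv`). It respects every set defined over the prime field `ℚ` and is a
homeomorphism for the Zariski topologies, so it carries identity components along.

Hodge group. The similitudes commuting with `D` form an algebraic group over `ℚ` containing `μ_∞`,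
hence containing `MT`; this gives `H ⊆ L`. Conversely, `C` is the part of `DL_K` with trivial twist,
so the Sato–Tate hypothesis puts `C` inside the monodromy group
(`isoCentralizer_subset_algMonodromy`). Its identity component `L` then lies in `(G_l^alg)°`, hence
in `MT` (`lefschetz_subset_mumfordTate`), and being connected and isometric it lies in `H`. One
prime suffices.

Mumford–Tate. Over an algebraically closed field, a similitude commuting with `D` is a homothety
times an element of `C` (`exists_homothety_mul_of_isSimilitude`). Since `C ⊆ G_l^alg`, only the
homotheties are missing. For `σ ∈ ker ρe`, write `ρ_l(σ) = t u` with `t² = χ_c(σ)^(-n)` and `u ∈ C`;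
then the homothety `t` lies in `G_l^alg`. As `n ≠ 0`, infinitely many `t` arise, and a Zariski
closed set with infinitely many homotheties contains them all (`homothety_mem_algMonodromy`). Thus
`MT ⊆ G_l^alg`, and `MT` lands in the identity component because it is connected.

Connectedness of `MT` (`HodgeStructure.isPreconnected_mumfordTate`) needs `MT°` to be defined over
`ℚ`. This follows from a Galois-type descent: a closed set stable under all automorphisms of `ℂ` has
rational equations, because the fixed field of these automorphisms is `ℚ`. -/

/-- `K` is an algebraic closure of the subring `R[v]`, a polynomial ring, and isomorphisms of the
base extend to algebraic closures. -/
theorem exists_ringEquiv_aeval_of_isTranscendenceBasis {R K ι : Type*} [CommRing R] [Field K]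
    [Algebra R K] [IsAlgClosed K] {v : ι → K} (hv : IsTranscendenceBasis R v)
    (e : MvPolynomial ι R ≃+* MvPolynomial ι R) :
    ∃ σ : K ≃+* K, ∀ p, σ (MvPolynomial.aeval v p) = MvPolynomial.aeval v (e p) := by
  let := IsAlgClosed.isAlgClosure_of_transcendence_basis v hv
  let a := hv.1.aevalEquiv.toRingEquiv
  refine ⟨IsAlgClosure.equivOfEquiv K K ((a.symm.trans e).trans a), fun p => ?_⟩
  have h := IsAlgClosure.equivOfEquiv_algebraMap K K ((a.symm.trans e).trans a) (a p)
  simpa [a] using h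

/-- An algebraic `x` is moved by a Galois automorphism of the algebraic closure of `k` in `K`,
extended coefficientwise along a transcendence basis. A transcendental `x` is put into a
transcendence basis and sent to `-x`. -/
theorem exists_ringEquiv_ne {k K : Type*} [Field k] [CharZero k] [Field K] [IsAlgClosed K]
    [Algebra k K] {x : K} (hx : ∀ q : k, x ≠ algebraMap k K q) : ∃ σ : K ≃+* K, σ x ≠ x := by
  have : CharZero K := charZero_of_injective_algebraMap (algebraMap k K).injective
  by_cases hxa : IsAlgebraic k x
  · let F := algebraicClosure k K
    have : Normal k F := IsAlgClosure.normal k F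
    have : IsGalois k F := ⟨⟩
    let y : F := ⟨x, mem_algebraicClosure_iff.2 hxa⟩
    obtain ⟨τ, hτ⟩ : ∃ τ : Gal(F/k), τ y ≠ y := by
      by_contra! H
      obtain ⟨q, hq⟩ := (InfiniteGalois.mem_bot_iff_fixed y).2 H
      exact hx q ((congrArg (algebraMap F K) hq.symm).trans (IsScalarTower.algebraMap_apply k F K q).symm)
    obtain ⟨s, hs⟩ := exists_isTranscendenceBasis F K
    obtain ⟨σ, hσ⟩ := exists_ringEquiv_aeval_of_isTranscendenceBasis hs
      (MvPolynomial.mapEquiv s τ.toRingEquiv)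
    refine ⟨σ, fun h => hτ ?_⟩
    have := hσ (MvPolynomial.C y)
    simp only [MvPolynomial.mapEquiv_apply, MvPolynomial.map_C, MvPolynomial.aeval_C] at this
    exact (algebraMap F K).injective (this.symm.trans h)
  · have hi : AlgebraicIndepOn k id ({x} : Set K) :=
      algebraicIndependent_unique_type_iff.2 hxa
    obtain ⟨s, hxs, hs⟩ := exists_isTranscendenceBasis_superset hi
    have hn : (MvPolynomial.aeval (R := k) (fun i : s => -MvPolynomial.X (R := k) i)).comp
        (MvPolynomial.aeval (R := k) (fun i : s => -MvPolynomial.X (R := k) i)) =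
        AlgHom.id k (MvPolynomial s k) := by
      ext; simp
    obtain ⟨σ, hσ⟩ := exists_ringEquiv_aeval_of_isTranscendenceBasis hs
      (AlgEquiv.ofAlgHom _ _ hn hn).toRingEquiv
    refine ⟨σ, fun h => hx 0 ?_⟩
    have := hσ (MvPolynomial.X ⟨x, hxs rfl⟩)
    simp at this
    rw [h] at this
    simpa using self_eq_neg.1 this

/-- Steinitz: uncountable algebraically closed fields of characteristic zero are classified by their
cardinality, here the continuum on both sides. -/
theorem nonempty_complex_ringEquiv (l : ℕ) [Fact l.Prime] :
    Nonempty (ℂ ≃+* AlgebraicClosure ℚ_[l]) := by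
  have h1 : Cardinal.mk ℚ_[l] ≤ Cardinal.continuum := by
    refine (Cardinal.mk_le_of_surjective (f := fun s : CauSeq ℚ (padicNorm l) =>
      (CauSeq.Completion.mk s : ℚ_[l])) Quotient.mk_surjective).trans ?_
    refine (Cardinal.mk_le_of_injective (f := fun s : CauSeq ℚ (padicNorm l) => (s : ℕ → ℚ))
      Subtype.coe_injective).trans ?_
    simp
  have h2 : Cardinal.mk (AlgebraicClosure ℚ_[l]) ≤ Cardinal.continuum :=
    (Algebra.IsAlgebraic.cardinalMk_le_max ℚ_[l] _).trans
      (max_le h1 Cardinal.aleph0_le_continuum)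
  have h3 : Cardinal.continuum ≤ Cardinal.mk (AlgebraicClosure ℚ_[l]) :=
    (continuum_le_cardinal_of_nontriviallyNormedField ℚ_[l]).trans
      (Cardinal.mk_le_of_injective (algebraMap ℚ_[l] (AlgebraicClosure ℚ_[l])).injective)
  refine IsAlgClosed.ringEquiv_of_equiv_of_charZero ?_ (Cardinal.eq.1 ?_)
  · rw [Cardinal.mk_complex]; exact Cardinal.aleph0_lt_continuum
  · rw [Cardinal.mk_complex]; exact le_antisymm h3 h2

theorem finite_zpow_eq {R : Type*} [CommRing R] [IsDomain R] {n : ℤ} (hn : n ≠ 0) (t : Rˣ) :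
    {x : Rˣ | x ^ n = t}.Finite := by
  have hpow : ∀ {m : ℕ}, m ≠ 0 → ∀ t : Rˣ, {x : Rˣ | x ^ m = t}.Finite := by
    intro m hm t
    refine Set.Finite.of_finite_image
      (((Polynomial.nthRoots m (t : R)).finite_toSet).subset ?_) Units.val_injective.injOn
    rintro _ ⟨x, hx, rfl⟩
    refine (Polynomial.mem_nthRoots (Nat.pos_of_ne_zero hm)).2 ?_
    exact_mod_cast congrArg Units.val hx
  obtain ⟨m, rfl | rfl⟩ := n.eq_nat_or_neg
  · simpa using hpow (by simpa using hn) t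
  · simpa [inv_eq_iff_eq_inv] using hpow (by simpa using hn) t⁻¹

/-! ### Infinite image of powers of the cyclotomic character on open subgroups. -/

section Cyclotomic

variable {K Kbar : Type*} [Field K] [NumberField K] [Field Kbar] [Algebra K Kbar]
  [IsAlgClosure K Kbar]

/-- `U` contains the automorphisms fixing some finite extension `E` of `K`. If the character takes
`N` values on `U`, a primitive `l^k`-th root of unity has at most `N` conjugates over `E`, so its
degree over `ℚ` is at most `[E : ℚ] N`. -/
theorem exists_totient_le_of_finite_cyclotomicCharacter (l : ℕ) [Fact l.Prime]
    {U : Subgroup Gal(Kbar/K)} (hU : IsOpen (U : Set Gal(Kbar/K)))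
    (hfin : {x | ∃ σ ∈ U, cyclotomicCharacter Kbar l σ.toRingEquiv = x}.Finite) :
    ∃ B : ℕ, ∀ k : ℕ, (l ^ k).totient ≤ B := by
  have : IsAlgClosed Kbar := IsAlgClosure.isAlgClosed K
  have : CharZero Kbar := charZero_of_injective_algebraMap (algebraMap K Kbar).injective
  have : Normal K Kbar := IsAlgClosure.normal K Kbar
  obtain ⟨E, hE, hEU⟩ := (krullTopology_mem_nhds_one_iff K Kbar _).1 (hU.mem_nhds U.one_mem)
  have : FiniteDimensional ℚ E := Module.Finite.trans K E
  refine ⟨Module.finrank ℚ E * hfin.toFinset.card, fun k => ?_⟩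
  have hlk : 0 < l ^ k := pow_pos (Fact.out : l.Prime).pos k
  have : NeZero (l ^ k) := ⟨hlk.ne'⟩
  have : NeZero ((l ^ k : ℕ) : Kbar) := ⟨by exact_mod_cast hlk.ne'⟩
  obtain ⟨ζ, hζ⟩ := HasEnoughRootsOfUnity.exists_primitiveRoot Kbar (l ^ k)
  have hint : IsIntegral E ζ := Algebra.IsIntegral.isIntegral ζ
  have hdeg : (minpoly E ζ).natDegree ≤ hfin.toFinset.card := by
    classical
    rw [← Polynomial.card_rootSet_eq_natDegree (K := Kbar)
      (Algebra.IsSeparable.isSeparable E ζ) (IsAlgClosed.splits _), ← Set.toFinset_card]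
    refine (Finset.card_le_card ?_).trans (Finset.card_image_le
      (f := fun x : ℤ_[l]ˣ => ζ ^ (PadicInt.toZModPow k (x : ℤ_[l])).val))
    intro y hy
    rw [Set.mem_toFinset, Polynomial.mem_rootSet] at hy
    -- Every conjugate of `ζ` over `E` is `τ ζ` with `τ` fixing `E`, hence in `U`, and `τ ζ` is a
    -- power of `ζ` determined by the character at `τ`.
    obtain ⟨τ, hτ⟩ := minpoly.exists_algEquiv_of_root' (Algebra.IsAlgebraic.isAlgebraic ζ) hy.2
    refine Finset.mem_image.2 ⟨_, hfin.mem_toFinset.2 ⟨τ.restrictScalars K, hEU ?_, rfl⟩, ?_⟩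
    · exact fun z => τ.commutes z
    · rw [← cyclotomicCharacter.spec l _ ζ hζ.pow_eq_one]
      exact hτ
  have hfd : FiniteDimensional E (IntermediateField.adjoin E {ζ}) :=
    IntermediateField.adjoin.finiteDimensional hint
  have hfd' : FiniteDimensional ℚ (IntermediateField.adjoin E {ζ}) := Module.Finite.trans E _
  calc (l ^ k).totient = (minpoly ℚ ζ).natDegree := by
        rw [← Polynomial.cyclotomic_eq_minpoly_rat hζ hlk, Polynomial.natDegree_cyclotomic]
    _ = (minpoly ℚ (IntermediateField.AdjoinSimple.gen E ζ)).natDegree := by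
        rw [← minpoly.algebraMap_eq (A := ℚ) (algebraMap (IntermediateField.adjoin E {ζ}) Kbar).injective]
        rfl
    _ ≤ Module.finrank ℚ (IntermediateField.adjoin E {ζ}) := minpoly.natDegree_le _
    _ = Module.finrank ℚ E * Module.finrank E (IntermediateField.adjoin E {ζ}) :=
        (Module.finrank_mul_finrank ℚ E _).symm
    _ ≤ _ := by
        rw [IntermediateField.adjoin.finrank hint]
        exact Nat.mul_le_mul_left _ hdeg

theorem infinite_cyclotomicCharacter_zpow (l : ℕ) [Fact l.Prime] {U : Subgroup Gal(Kbar/K)}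
    (hU : IsOpen (U : Set Gal(Kbar/K))) {n : ℤ} (hn : n ≠ 0) :
    {x | ∃ σ ∈ U, cyclotomicCharacter Kbar l σ.toRingEquiv ^ n = x}.Infinite := by
  intro hfin
  obtain ⟨B, hB⟩ := exists_totient_le_of_finite_cyclotomicCharacter l hU
    ((hfin.preimage' (f := fun x => x ^ n) fun t _ => finite_zpow_eq hn t).subset
      (by rintro _ ⟨σ, hσ, rfl⟩; exact ⟨σ, hσ, rfl⟩))
  have hp : l.Prime := Fact.out
  -- The exponent `B + 1` is large enough: the totient is `l ^ B * (l - 1)`, which exceeds `B`.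
  have h1 := hB (B + 1)
  rw [Nat.totient_prime_pow_succ hp] at h1
  have h2 : B < l ^ B := Nat.lt_pow_self hp.one_lt
  have h3 : 1 ≤ l - 1 := Nat.le_sub_one_of_lt hp.one_lt
  nlinarith

end Cyclotomic

/-! ### Functoriality of points of `GL_V` in the coefficient ring. -/

section BaseChange

variable {V : Type*} [AddCommGroup V] [Module ℚ V] [FiniteDimensional ℚ V]
variable {R S T : Type*} [CommRing R] [Algebra ℚ R] [CommRing S] [Algebra ℚ S]
  [CommRing T] [Algebra ℚ T]

/-- The matrix of a point of `GL_V` with respect to the chosen basis of `V`. -/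
def toGL (R : Type*) [CommRing R] [Algebra ℚ R] (V : Type*) [AddCommGroup V] [Module ℚ V]
    [FiniteDimensional ℚ V] : GLPoints R V ≃* GL (Fin (Module.finrank ℚ V)) R :=
  Units.mapEquiv (LinearMap.toMatrixAlgEquiv ((Module.finBasis ℚ V).baseChange R)).toMulEquiv

theorem toGL_apply (g : GLPoints R V) (i j : Fin (Module.finrank ℚ V)) :
    (toGL R V g : Matrix _ _ R) i j = entries g (i, j) := rfl

theorem entries_injective : Function.Injective (entries (R := R) (V := V)) := by
  intro g g' h
  apply (toGL R V).injective
  ext i j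
  exact congrFun h (i, j)

theorem entries_mul (g g' : GLPoints R V) (i j : Fin (Module.finrank ℚ V)) :
    entries (g * g') (i, j) = ∑ m, entries g (i, m) * entries g' (m, j) := by
  simp only [← toGL_apply, map_mul, Units.val_mul, Matrix.mul_apply]

/-- The map on points of `GL_V` induced by a ring homomorphism. -/
def mapPoints (φ : R →+* S) : GLPoints R V →* GLPoints S V :=
  (toGL S V).symm.toMonoidHom.comp
    ((Matrix.GeneralLinearGroup.map φ).comp (toGL R V).toMonoidHom)

theorem toGL_mapPoints (φ : R →+* S) (g : GLPoints R V) :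
    toGL S V (mapPoints φ g) = Matrix.GeneralLinearGroup.map φ (toGL R V g) :=
  (toGL S V).apply_symm_apply _

theorem entries_mapPoints (φ : R →+* S) (g : GLPoints R V)
    (ij : Fin (Module.finrank ℚ V) × Fin (Module.finrank ℚ V)) :
    entries (mapPoints φ g) ij = φ (entries g ij) := by
  obtain ⟨i, j⟩ := ij
  rw [← toGL_apply, toGL_mapPoints]
  rfl

theorem mapPoints_comp (φ : R →+* S) (χ : S →+* T) (g : GLPoints R V) :
    mapPoints χ (mapPoints φ g) = mapPoints (χ.comp φ) g :=
  entries_injective (funext fun ij => by simp [entries_mapPoints])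

theorem mapPoints_id (g : GLPoints R V) : mapPoints (RingHom.id R) g = g :=
  entries_injective (funext fun ij => by simp [entries_mapPoints])

theorem mapPoints_symm_apply (φ : R ≃+* S) (g : GLPoints S V) :
    mapPoints (φ : R →+* S) (mapPoints (φ.symm : S →+* R) g) = g := by
  rw [mapPoints_comp]
  simpa using mapPoints_id g

theorem evalAt_mapPoints {k : Type*} [CommRing k] [Algebra k R] [Algebra k S] (φ : R →ₐ[k] S)
    (f : EntryPoly k V) (g : GLPoints R V) :
    evalAt f (mapPoints (φ : R →+* S) g) = φ (evalAt f g) := by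
  have : entries (mapPoints (φ : R →+* S) g) = fun ij => φ (entries g ij) :=
    funext fun ij => entries_mapPoints _ g ij
  rw [evalAt, this, evalAt]
  exact (MvPolynomial.comp_aeval_apply (entries g) φ f).symm

theorem evalAt_rat_mapPoints (φ : R →+* S) (f : EntryPoly ℚ V) (g : GLPoints R V) :
    evalAt f (mapPoints φ g) = φ (evalAt f g) :=
  evalAt_mapPoints φ.toRatAlgHom f g

/-- The semilinear form of compatibility: `φ` acts on the coefficients as well, as required for
abstract field automorphisms. -/
theorem evalAt_map_mapPoints (φ : R →+* S) (f : EntryPoly R V) (g : GLPoints R V) :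
    evalAt (MvPolynomial.map φ f) (mapPoints φ g) = φ (evalAt f g) := by
  have : entries (mapPoints φ g) = fun ij => φ (entries g ij) :=
    funext fun ij => entries_mapPoints _ g ij
  rw [evalAt, this, evalAt]
  induction f using MvPolynomial.induction_on with
  | C a => simp
  | add p q hp hq => rw [map_add, map_add, map_add, map_add, hp, hq]
  | mul_X p i hp =>
    rw [map_mul, map_mul, map_mul, map_mul, hp, MvPolynomial.map_X, MvPolynomial.aeval_X,
      MvPolynomial.aeval_X]

theorem subset_zariskiClosure {k : Type*} [CommRing k] [Algebra k R] (X : Set (GLPoints R V)) :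
    X ⊆ zariskiClosure k R X := fun _ hx _ hf => hf _ hx

theorem zariskiClosure_eq_of_isAlgebraicOver {k : Type*} [CommRing k] [Algebra k R]
    {X : Set (GLPoints R V)} (hX : IsAlgebraicOver k X) : zariskiClosure k R X = X := by
  obtain ⟨S, rfl⟩ := hX
  exact (subset_zariskiClosure _).antisymm' fun g hg f hf => hg f fun x hx => hx f hf

theorem mapPoints_mem_zariskiClosure_rat (φ : R →+* S) {X : Set (GLPoints R V)} {g : GLPoints R V}
    (hg : g ∈ zariskiClosure ℚ R X) : mapPoints φ g ∈ zariskiClosure ℚ S X := fun f hf => by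
  rw [evalAt_rat_mapPoints, hg f hf, map_zero]

/-- Ring homomorphisms fix rational coefficients, so an injective `φ` reflects the vanishing of
rational polynomials. -/
theorem mem_of_mapPoints_mem_zariskiClosure_rat {φ : R →+* S} (hφ : Function.Injective φ)
    {X : Set (GLPoints R V)} (hX : IsAlgebraicOver ℚ X) {g : GLPoints R V}
    (hg : mapPoints φ g ∈ zariskiClosure ℚ S X) : g ∈ X := by
  rw [← zariskiClosure_eq_of_isAlgebraicOver hX]
  intro f hf
  have := hg f hf
  rwa [evalAt_rat_mapPoints, map_eq_zero_iff φ hφ] at this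

theorem IsAlgebraicOver.inter {k : Type*} [CommRing k] [Algebra k R] {X Y : Set (GLPoints R V)}
    (hX : IsAlgebraicOver k X) (hY : IsAlgebraicOver k Y) : IsAlgebraicOver k (X ∩ Y) := by
  obtain ⟨S, rfl⟩ := hX
  obtain ⟨T, rfl⟩ := hY
  refine ⟨S ∪ T, Set.ext fun g => ?_⟩
  simp only [Set.mem_inter_iff, Set.mem_ofPred_eq, Set.mem_union, or_imp, forall_and]

theorem isAlgebraicOver_iInter {k : Type*} [CommRing k] [Algebra k R] {ι : Sort*}
    {X : ι → Set (GLPoints R V)} (hX : ∀ i, IsAlgebraicOver k (X i)) :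
    IsAlgebraicOver k (⋂ i, X i) := by
  choose S hS using hX
  refine ⟨⋃ i, S i, Set.ext fun g => ?_⟩
  simp only [hS, Set.mem_iInter, Set.mem_ofPred_eq, Set.mem_iUnion, forall_exists_index]
  exact forall_comm

end BaseChange

/-! ### The Zariski topology -/

section Zariski

variable {V : Type*} [AddCommGroup V] [Module ℚ V] [FiniteDimensional ℚ V]
variable {Ω Ω' : Type*} [Field Ω] [Algebra ℚ Ω] [Field Ω'] [Algebra ℚ Ω']

attribute [local instance] zariskiTopology

theorem isOpen_evalAt_ne (f : EntryPoly Ω V) : IsOpen {g : GLPoints Ω V | evalAt f g ≠ 0} :=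
  TopologicalSpace.isOpen_generateFrom_of_mem ⟨f, rfl⟩

theorem isTopologicalBasis_evalAt_ne :
    TopologicalSpace.IsTopologicalBasis
      {U : Set (GLPoints Ω V) | ∃ f : EntryPoly Ω V, U = {g | evalAt f g ≠ 0}} where
  exists_subset_inter := by
    rintro _ ⟨f, rfl⟩ _ ⟨f', rfl⟩ g ⟨hg, hg'⟩
    exact ⟨_, ⟨f * f', rfl⟩, by simpa [evalAt] using ⟨hg, hg'⟩,
      fun x hx => by simpa [evalAt] using hx⟩
  sUnion_eq := by
    refine Set.eq_univ_of_forall fun g => ?_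
    exact ⟨_, ⟨1, rfl⟩, by simp [evalAt]⟩
  eq_generateFrom := rfl

theorem closure_eq_zariskiClosure (X : Set (GLPoints Ω V)) :
    closure X = zariskiClosure Ω Ω X := by
  ext g
  rw [isTopologicalBasis_evalAt_ne.mem_closure_iff]
  constructor
  · intro H f hf
    by_contra hg
    obtain ⟨x, hx, hxX⟩ := H _ ⟨f, rfl⟩ hg
    exact hx (hf x hxX)
  · rintro H _ ⟨f, rfl⟩ hg
    by_contra hX
    exact hg (H f fun x hx => by_contra fun h => hX ⟨x, h, hx⟩)

/-- Only zero loci are compared, not values; this form also covers maps induced by field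
isomorphisms, which are not morphisms of varieties. -/
theorem continuous_of_forall_evalAt {F : GLPoints Ω V → GLPoints Ω' V}
    (hF : ∀ f : EntryPoly Ω' V, ∃ f' : EntryPoly Ω V, ∀ g, evalAt f (F g) = 0 ↔ evalAt f' g = 0) :
    Continuous F := by
  refine continuous_generateFrom_iff.2 ?_
  rintro _ ⟨f, rfl⟩
  obtain ⟨f', hf'⟩ := hF f
  convert isOpen_evalAt_ne f' using 1
  ext g
  exact not_congr (hf' g)

theorem continuous_mul_left_zariski (a : GLPoints Ω V) :
    Continuous fun g : GLPoints Ω V => a * g := by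
  refine continuous_of_forall_evalAt fun f => ⟨MvPolynomial.aeval (fun ij =>
    ∑ m, MvPolynomial.C (entries a (ij.1, m)) * MvPolynomial.X (m, ij.2)) f, fun g => ?_⟩
  rw [evalAt, evalAt, MvPolynomial.comp_aeval_apply]
  have : entries (a * g) = fun ij => ∑ m, entries a (ij.1, m) * entries g (m, ij.2) :=
    funext fun ij => entries_mul a g ij.1 ij.2
  simp [this]

theorem continuous_mul_right_zariski (a : GLPoints Ω V) :
    Continuous fun g : GLPoints Ω V => g * a := by
  refine continuous_of_forall_evalAt fun f => ⟨MvPolynomial.aeval (fun ij =>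
    ∑ m, MvPolynomial.X (ij.1, m) * MvPolynomial.C (entries a (m, ij.2))) f, fun g => ?_⟩
  rw [evalAt, evalAt, MvPolynomial.comp_aeval_apply]
  have : entries (g * a) = fun ij => ∑ m, entries g (ij.1, m) * entries a (m, ij.2) :=
    funext fun ij => entries_mul g a ij.1 ij.2
  simp [this]

theorem continuous_mapPoints (φ : Ω ≃+* Ω') :
    Continuous (mapPoints (φ : Ω →+* Ω') : GLPoints Ω V → GLPoints Ω' V) := by
  refine continuous_of_forall_evalAt fun f =>
    ⟨MvPolynomial.map (φ.symm : Ω' →+* Ω) f, fun g => ?_⟩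
  rw [← map_eq_zero_iff (φ : Ω →+* Ω') φ.injective, ← evalAt_map_mapPoints, MvPolynomial.map_map]
  simp [MvPolynomial.map_id]

/-- Multiplication need not be jointly continuous for the product of Zariski topologies, so the two
factors are moved to the closure one at a time by translations. -/
theorem mul_mem_closure_of_mul_mem {X : Set (GLPoints Ω V)} (hX : ∀ x ∈ X, ∀ y ∈ X, x * y ∈ X)
    {x y : GLPoints Ω V} (hx : x ∈ closure X) (hy : y ∈ closure X) : x * y ∈ closure X := by
  have h1 : ∀ a ∈ X, ∀ y ∈ closure X, a * y ∈ closure X := fun a ha y hy =>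
    map_mem_closure (continuous_mul_left_zariski a) hy fun b hb => hX a ha b hb
  have := map_mem_closure (continuous_mul_right_zariski y) hx
    (t := closure X) fun a ha => h1 a ha y hy
  rwa [closure_closure] at this

/-! ### Identity components -/

theorem identityComponent_subset (X : Set (GLPoints Ω V)) : identityComponent X ⊆ X :=
  connectedComponentIn_subset _ _

theorem one_mem_identityComponent {X : Set (GLPoints Ω V)} (h1 : 1 ∈ X) :
    1 ∈ identityComponent X := mem_connectedComponentIn h1

theorem isPreconnected_identityComponent (X : Set (GLPoints Ω V)) :
    IsPreconnected (identityComponent X) := isPreconnected_connectedComponentIn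

theorem subset_identityComponent {X Y : Set (GLPoints Ω V)} (hY : IsPreconnected Y) (h1 : 1 ∈ Y)
    (hYX : Y ⊆ X) : Y ⊆ identityComponent X :=
  hY.subset_connectedComponentIn h1 hYX

theorem identityComponent_mono {X Y : Set (GLPoints Ω V)} (h : X ⊆ Y) :
    identityComponent X ⊆ identityComponent Y :=
  connectedComponentIn_mono _ h

theorem isClosed_identityComponent {X : Set (GLPoints Ω V)} (h1 : 1 ∈ X) (hX : IsClosed X) :
    IsClosed (identityComponent X) := by
  refine isClosed_of_closure_subset (subset_identityComponent
    (isPreconnected_identityComponent X).closure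
    (subset_closure (one_mem_identityComponent h1)) ?_)
  exact closure_minimal (identityComponent_subset X) hX

/-- The identity component of a group is a group. -/
def identityComponentSubgroup (M : Subgroup (GLPoints Ω V)) : Subgroup (GLPoints Ω V) where
  carrier := identityComponent (M : Set (GLPoints Ω V))
  one_mem' := one_mem_identityComponent M.one_mem
  mul_mem' := by
    intro a b ha hb
    have hsub : (fun g => g * b) '' identityComponent (M : Set (GLPoints Ω V)) ⊆ M := by
      rintro _ ⟨g, hg, rfl⟩
      exact M.mul_mem (identityComponent_subset _ hg) (identityComponent_subset _ hb)
    have hb' : b ∈ (fun g => g * b) '' identityComponent (M : Set (GLPoints Ω V)) :=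
      ⟨1, one_mem_identityComponent M.one_mem, one_mul b⟩
    -- The component and its translate by `b` share the point `b`, so their union is connected.
    have hc : IsPreconnected (identityComponent (M : Set (GLPoints Ω V)) ∪
        (fun g => g * b) '' identityComponent (M : Set (GLPoints Ω V))) :=
      (isPreconnected_identityComponent _).union b hb hb'
        ((isPreconnected_identityComponent _).image _ (continuous_mul_right_zariski b).continuousOn)
    exact subset_identityComponent hc (Or.inl (one_mem_identityComponent M.one_mem))
      (Set.union_subset (identityComponent_subset _) hsub) (Or.inr ⟨a, ha, rfl⟩)
  inv_mem' := by
    intro a ha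
    -- The left translate by `a⁻¹` is connected and contains both `1` and `a⁻¹`.
    refine subset_identityComponent ((isPreconnected_identityComponent (M : Set (GLPoints Ω V))).image
      _ (continuous_mul_left_zariski a⁻¹).continuousOn) ⟨a, ha, inv_mul_cancel a⟩ ?_
      ⟨1, one_mem_identityComponent M.one_mem, mul_one _⟩
    rintro _ ⟨g, hg, rfl⟩
    exact M.mul_mem (M.inv_mem (identityComponent_subset _ ha)) (identityComponent_subset _ hg)

theorem mapPoints_mem_identityComponent (φ : Ω ≃+* Ω') {X : Set (GLPoints Ω V)}
    {Y : Set (GLPoints Ω' V)} (h1 : 1 ∈ X)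
    (hXY : ∀ x ∈ identityComponent X, mapPoints (φ : Ω →+* Ω') x ∈ Y) {x : GLPoints Ω V}
    (hx : x ∈ identityComponent X) : mapPoints (φ : Ω →+* Ω') x ∈ identityComponent Y :=
  subset_identityComponent
    ((isPreconnected_identityComponent X).image _ (continuous_mapPoints φ).continuousOn)
    ⟨1, one_mem_identityComponent h1, map_one _⟩ (Set.image_subset_iff.2 hXY) ⟨x, hx, rfl⟩

end Zariski

/-! ### Fields of definition -/

section Descent

/-- Since `Ω[X] = Ω ⊗ k[X]`, a polynomial over `Ω` has coordinates in `k[X]` along a `k`-basis of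
`Ω`. -/
theorem exists_aeval_eq_sum_basis {k Ω σ ι : Type*} [Field k] [Field Ω] [Algebra k Ω]
    (e : Module.Basis ι k Ω) (f : MvPolynomial σ Ω) :
    ∃ c : ι →₀ MvPolynomial σ k, ∀ x : σ → Ω,
      MvPolynomial.aeval x f = c.sum fun i m => e i * MvPolynomial.aeval x m := by
  obtain ⟨c, hc⟩ := TensorProduct.eq_repr_basis_left e
    ((MvPolynomial.algebraTensorAlgEquiv k Ω).symm f)
  refine ⟨c, fun x => ?_⟩
  have hf : f = MvPolynomial.algebraTensorAlgEquiv k Ω (c.sum fun i m => e i ⊗ₜ[k] m) := by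
    rw [hc, AlgEquiv.apply_symm_apply]
  rw [hf, Finsupp.sum, map_sum, map_sum]
  refine Finset.sum_congr rfl fun i _ => ?_
  simp [MvPolynomial.aeval_map_algebraMap]

/-- Artin's argument: a linear relation with linearly independent coefficients that is stable under
all automorphisms is trivial. -/
theorem eq_zero_of_forall_ringEquiv_sum_eq_zero {k Ω ι : Type*} [Field k] [Field Ω] [Algebra k Ω]
    (hfix : ∀ x : Ω, (∀ σ : Ω ≃+* Ω, σ x = x) → x ∈ (algebraMap k Ω).range) {e : ι → Ω}
    (he : LinearIndependent k e) (y : ι →₀ Ω)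
    (hy : ∀ σ : Ω ≃+* Ω, (y.sum fun i a => e i * σ a) = 0) : y = 0 := by
  classical
  induction hN : y.support.card using Nat.strong_induction_on generalizing y with
  | _ N ih =>
  by_contra hne
  obtain ⟨i₀, hi₀⟩ := Finsupp.ne_iff.1 hne
  rw [Finsupp.zero_apply] at hi₀
  have hfixed : ∀ i, ∀ τ : Ω ≃+* Ω, τ ((y i₀)⁻¹ * y i) = (y i₀)⁻¹ * y i := by
    intro i τ
    -- Normalise `y` to have coordinate `1` at `i₀` and subtract this from its image under `τ`. The
    -- difference vanishes at `i₀` and satisfies the same relations, so it is zero by induction on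
    -- the support.
    let z : ι →₀ Ω := Finsupp.onFinset y.support
      (fun i => τ ((y i₀)⁻¹ * y i) - (y i₀)⁻¹ * y i) (by
        intro i hi
        rw [Finsupp.mem_support_iff]
        rintro h
        simp [h] at hi)
    have hsub : z.support ⊆ y.support.erase i₀ := by
      intro i hi
      have hzi : z i ≠ 0 := Finsupp.mem_support_iff.1 hi
      refine Finset.mem_erase.2 ⟨?_, Finsupp.support_onFinset_subset hi⟩
      rintro rfl
      exact hzi (by simp [z, hi₀])
    have hz : z = 0 := by
      refine ih _ ?_ z (fun σ => ?_) rfl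
      · rw [← hN]
        exact (Finset.card_le_card hsub).trans_lt
          (Finset.card_erase_lt_of_mem (Finsupp.mem_support_iff.2 hi₀))
      · rw [Finsupp.onFinset_sum _ (by simp)]
        have h1 := hy (τ.trans σ)
        have h2 := hy σ
        rw [Finsupp.sum] at h1 h2
        calc ∑ i ∈ y.support, e i * σ (τ ((y i₀)⁻¹ * y i) - (y i₀)⁻¹ * y i)
            = σ (τ (y i₀)⁻¹) * (∑ i ∈ y.support, e i * (τ.trans σ) (y i))
              - σ (y i₀)⁻¹ * ∑ i ∈ y.support, e i * σ (y i) := by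
              rw [Finset.mul_sum, Finset.mul_sum, ← Finset.sum_sub_distrib]
              refine Finset.sum_congr rfl fun i _ => ?_
              simp only [map_sub, map_mul, RingEquiv.coe_trans, Function.comp_apply]
              ring
          _ = 0 := by rw [h1, h2, mul_zero, mul_zero, sub_zero]
    exact sub_eq_zero.1 (DFunLike.congr_fun hz i)
  choose q hq using fun i => hfix _ (hfixed i)
  -- All ratios lie in `k`, so the identity automorphism yields a `k`-linear relation whose
  -- coefficient at `i₀` is `1`.
  have hsum : ∑ i ∈ y.support, q i • e i = 0 := by
    have h1 := hy (RingEquiv.refl Ω)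
    rw [Finsupp.sum] at h1
    calc ∑ i ∈ y.support, q i • e i = (y i₀)⁻¹ * ∑ i ∈ y.support, e i * y i := by
          rw [Finset.mul_sum]
          refine Finset.sum_congr rfl fun i _ => ?_
          rw [Algebra.smul_def, hq]
          ring
      _ = 0 := by
          rw [show ∑ i ∈ y.support, e i * y i = 0 from h1, mul_zero]
  have := linearIndependent_iff'.1 he _ _ hsum i₀ (Finsupp.mem_support_iff.2 hi₀)
  have h1 := hq i₀
  rw [this, map_zero, inv_mul_cancel₀ hi₀] at h1
  exact zero_ne_one h1

variable {V : Type*} [AddCommGroup V] [Module ℚ V] [FiniteDimensional ℚ V]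

theorem exists_evalAt_eq_sum_basis {k Ω ι : Type*} [Field k] [Field Ω] [Algebra k Ω] [Algebra ℚ Ω]
    (e : Module.Basis ι k Ω) (f : EntryPoly Ω V) :
    ∃ c : ι →₀ EntryPoly k V, ∀ g : GLPoints Ω V,
      evalAt f g = c.sum fun i m => e i * evalAt m g :=
  (exists_aeval_eq_sum_basis e f).imp fun _ hc g => hc (entries g)

attribute [local instance] zariskiTopology

/-- A Zariski closed set that is stable under all field automorphisms is defined over `ℚ`. -/
theorem isAlgebraicOver_rat_of_forall_ringEquiv {Ω : Type*} [Field Ω] [IsAlgClosed Ω]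
    [Algebra ℚ Ω] {X : Set (GLPoints Ω V)} (hX : IsClosed X)
    (hσ : ∀ σ : Ω ≃+* Ω, ∀ x ∈ X, mapPoints (σ : Ω →+* Ω) x ∈ X) : IsAlgebraicOver ℚ X := by
  refine ⟨{f | ∀ x ∈ X, evalAt f x = 0}, (subset_zariskiClosure X).antisymm fun g hg => ?_⟩
  rw [← hX.closure_eq, closure_eq_zariskiClosure]
  intro f hf
  let e := Module.Basis.ofVectorSpace ℚ Ω
  obtain ⟨c, hc⟩ := exists_evalAt_eq_sum_basis e f
  have hfix : ∀ x : Ω, (∀ σ : Ω ≃+* Ω, σ x = x) → x ∈ (algebraMap ℚ Ω).range := by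
    intro x hx
    by_contra h
    obtain ⟨σ, h⟩ := exists_ringEquiv_ne (k := ℚ) (x := x) fun q hq => h ⟨q, hq.symm⟩
    exact h (hx σ)
  -- Evaluating `f` at the conjugates of `x`, which stay in `X`, gives a relation among the `e i`
  -- for every automorphism; Artin's argument kills each coordinate.
  have hvan : ∀ i, ∀ x ∈ X, evalAt (c i) x = 0 := by
    intro i x hx
    have := eq_zero_of_forall_ringEquiv_sum_eq_zero hfix e.linearIndependent
      (c.mapRange (fun m => evalAt m x) (by simp [evalAt])) fun σ => by
        rw [Finsupp.sum_mapRange_index (by simp), ← hf _ (hσ σ x hx), hc]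
        refine Finset.sum_congr rfl fun i _ => ?_
        beta_reduce
        rw [evalAt_rat_mapPoints]
        rfl
    exact DFunLike.congr_fun this i
  rw [hc]
  refine Finset.sum_eq_zero fun i _ => ?_
  beta_reduce
  rw [hg (c i) (hvan i), mul_zero]

/-- The Zariski closure of a set of `k`-points is defined over `k`. -/
theorem zariskiClosure_eq_closure_image {k Ω : Type*} [Field k] [Algebra ℚ k] [Field Ω]
    [Algebra ℚ Ω] [Algebra k Ω] (X : Set (GLPoints k V)) :
    zariskiClosure k Ω X = closure (mapPoints (algebraMap k Ω) '' X) := by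
  have key : ∀ (m : EntryPoly k V) (x : GLPoints k V),
      evalAt m (mapPoints (algebraMap k Ω) x) = algebraMap k Ω (evalAt m x) :=
    fun m x => evalAt_mapPoints (Algebra.ofId k Ω) m x
  rw [closure_eq_zariskiClosure]
  ext g
  constructor
  · intro hg f hf
    let e := Module.Basis.ofVectorSpace k Ω
    obtain ⟨c, hc⟩ := exists_evalAt_eq_sum_basis e f
    -- At a `k`-point the coordinates `c i` take values in `k`, so linear independence of `e`
    -- suffices.
    have hvan : ∀ i, ∀ x ∈ X, evalAt (c i) x = 0 := by
      intro i x hx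
      have h0 := hf _ ⟨x, hx, rfl⟩
      rw [hc, Finsupp.sum] at h0
      by_cases hi : i ∈ c.support
      · refine linearIndependent_iff'.1 e.linearIndependent c.support (fun i => evalAt (c i) x)
          ?_ i hi
        rw [← h0]
        refine Finset.sum_congr rfl fun i _ => ?_
        rw [key, Algebra.smul_def, mul_comm]
      · rw [Finsupp.notMem_support_iff.1 hi]
        simp [evalAt]
    rw [hc]
    refine Finset.sum_eq_zero fun i _ => ?_
    beta_reduce
    rw [hg (c i) (hvan i), mul_zero]
  · intro hg f hf
    have := hg (MvPolynomial.map (algebraMap k Ω) f) (by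
      rintro _ ⟨x, hx, rfl⟩
      rw [evalAt, MvPolynomial.aeval_map_algebraMap, ← evalAt, key, hf x hx, map_zero])
    rwa [evalAt, MvPolynomial.aeval_map_algebraMap] at this

end Descent

/-! ### One-parameter families -/

section Families

variable {V : Type*} [AddCommGroup V] [Module ℚ V] [FiniteDimensional ℚ V]
  {Ω : Type*} [Field Ω]

/-- The algebra of functions on `Ωˣ` that are Laurent polynomials. -/
def laurentFunctions (Ω : Type*) [Field Ω] : Subalgebra Ω (Ωˣ → Ω) where
  carrier := {F | ∃ (m : ℕ) (P : Polynomial Ω), ∀ t : Ωˣ, (t : Ω) ^ m * F t = P.eval (t : Ω)}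
  mul_mem' := by
    rintro F F' ⟨m, P, h⟩ ⟨m', P', h'⟩
    refine ⟨m + m', P * P', fun t => ?_⟩
    rw [Polynomial.eval_mul, ← h, ← h', Pi.mul_apply]
    ring
  add_mem' := by
    rintro F F' ⟨m, P, h⟩ ⟨m', P', h'⟩
    refine ⟨m + m', Polynomial.X ^ m' * P + Polynomial.X ^ m * P', fun t => ?_⟩
    simp only [Polynomial.eval_add, Polynomial.eval_mul, Polynomial.eval_pow, Polynomial.eval_X,
      ← h, ← h', Pi.add_apply]
    ring
  algebraMap_mem' a := ⟨0, Polynomial.C a, fun t => by simp⟩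

theorem zpow_mem_laurentFunctions (p : ℤ) :
    (fun t : Ωˣ => (t : Ω) ^ p) ∈ laurentFunctions Ω := by
  obtain ⟨m, rfl | rfl⟩ := p.eq_nat_or_neg
  · exact ⟨0, Polynomial.X ^ m, fun t => by simp⟩
  · exact ⟨m, 1, fun t => by simp⟩

theorem infinite_units [Infinite Ω] : Infinite Ωˣ := by
  have : Infinite {x : Ω // x ≠ 0} :=
    Set.infinite_coe_iff.2 (Set.finite_singleton (0 : Ω)).infinite_compl
  exact Infinite.of_injective (fun x : {x : Ω // x ≠ 0} => Units.mk0 x.1 x.2)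
    fun x y h => Subtype.ext (congrArg Units.val h)

theorem eq_zero_of_mem_laurentFunctions {F : Ωˣ → Ω} (hF : F ∈ laurentFunctions Ω)
    (h : {t | F t = 0}.Infinite) : F = 0 := by
  obtain ⟨m, P, hP⟩ := hF
  have : P = 0 := by
    refine Polynomial.eq_zero_of_infinite_isRoot P ((h.image Units.val_injective.injOn).mono ?_)
    rintro _ ⟨t, ht, rfl⟩
    change P.eval (t : Ω) = 0
    rw [← hP, show F t = 0 from ht, mul_zero]
  funext t
  have := hP t
  simpa [‹P = 0›] using this

variable [Algebra ℚ Ω]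

theorem evalAt_mem_laurentFunctions {γ : Ωˣ → GLPoints Ω V}
    (hγ : ∀ ij, (fun t => entries (γ t) ij) ∈ laurentFunctions Ω) (f : EntryPoly Ω V) :
    (fun t => evalAt f (γ t)) ∈ laurentFunctions Ω := by
  have : (fun t => evalAt f (γ t)) = MvPolynomial.aeval (fun ij t => entries (γ t) ij) f := by
    funext t
    exact (MvPolynomial.comp_aeval_apply (fun ij t => entries (γ t) ij)
      (Pi.evalAlgHom Ω (fun _ : Ωˣ => Ω) t) f).symm
  rw [this]
  clear this
  induction f using MvPolynomial.induction_on with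
  | C a =>
    rw [MvPolynomial.aeval_C]
    exact Subalgebra.algebraMap_mem _ a
  | add p q hp hq => rw [map_add]; exact add_mem hp hq
  | mul_X p i hp => rw [map_mul, MvPolynomial.aeval_X]; exact mul_mem hp (hγ i)

attribute [local instance] zariskiTopology

/-- The image is irreducible: if two nonempty basic open sets did not meet on it, one of two Laurent
polynomials would have infinitely many zeros and vanish identically. -/
theorem isPreconnected_range_of_laurent [Infinite Ω] {γ : Ωˣ → GLPoints Ω V}
    (hγ : ∀ ij, (fun t => entries (γ t) ij) ∈ laurentFunctions Ω) :
    IsPreconnected (Set.range γ) := by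
  refine IsPreirreducible.isPreconnected ?_
  rintro u v hu hv ⟨_, ⟨s, rfl⟩, hs⟩ ⟨_, ⟨t, rfl⟩, ht⟩
  obtain ⟨_, ⟨f, rfl⟩, hsf, hfu⟩ := isTopologicalBasis_evalAt_ne.exists_subset_of_mem_open hs hu
  obtain ⟨_, ⟨f', rfl⟩, htf, hfv⟩ := isTopologicalBasis_evalAt_ne.exists_subset_of_mem_open ht hv
  by_contra H
  have hor : ∀ r, evalAt f (γ r) = 0 ∨ evalAt f' (γ r) = 0 := by
    intro r
    by_contra! h
    exact H ⟨γ r, ⟨r, rfl⟩, hfu h.1, hfv h.2⟩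
  have hinf : ({r | evalAt f (γ r) = 0} ∪ {r | evalAt f' (γ r) = 0}).Infinite := by
    have := infinite_units (Ω := Ω)
    exact Set.infinite_univ.mono fun r _ => hor r
  rcases Set.infinite_union.1 hinf with h | h
  · exact hsf (congrFun (eq_zero_of_mem_laurentFunctions (evalAt_mem_laurentFunctions hγ f) h) s)
  · exact htf (congrFun (eq_zero_of_mem_laurentFunctions (evalAt_mem_laurentFunctions hγ f') h) t)

theorem mem_of_infinite_of_laurent {γ : Ωˣ → GLPoints Ω V}
    (hγ : ∀ ij, (fun t => entries (γ t) ij) ∈ laurentFunctions Ω) {X : Set (GLPoints Ω V)}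
    (hX : IsClosed X) (h : {t | γ t ∈ X}.Infinite) (t : Ωˣ) : γ t ∈ X := by
  rw [← hX.closure_eq, closure_eq_zariskiClosure]
  intro f hf
  exact congrFun (eq_zero_of_mem_laurentFunctions (evalAt_mem_laurentFunctions hγ f)
    (h.mono fun t ht => hf _ ht)) t

/-- Homotheties. -/
def homothety (Ω : Type*) [Field Ω] [Algebra ℚ Ω] (V : Type*) [AddCommGroup V] [Module ℚ V] :
    Ωˣ →* GLPoints Ω V :=
  Units.map (algebraMap Ω (Module.End Ω (Ω ⊗[ℚ] V))).toMonoidHom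

theorem entries_homothety_mem_laurentFunctions
    (ij : Fin (Module.finrank ℚ V) × Fin (Module.finrank ℚ V)) :
    (fun t => entries (homothety Ω V t) ij) ∈ laurentFunctions Ω := by
  have : (fun t => entries (homothety Ω V t) ij) =
      (fun t : Ωˣ => (t : Ω) ^ (1 : ℤ)) * algebraMap Ω (Ωˣ → Ω) (if ij.1 = ij.2 then 1 else 0) := by
    funext t
    rw [Pi.mul_apply, Pi.algebraMap_apply]
    simp [entries, homothety, Matrix.diagonal_apply]
  rw [this]
  exact mul_mem (zpow_mem_laurentFunctions 1) (Subalgebra.algebraMap_mem _ _)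

end Families

/-! ### Similitudes and centralizers -/

section Similitudes

variable {V : Type*} [AddCommGroup V] [Module ℚ V]
variable {R S : Type*} [CommRing R] [Algebra ℚ R] [CommRing S] [Algebra ℚ S]

/-- `g` is a similitude of `ψ` with multiplier `c`. -/
def IsSimilitude (ψ : LinearMap.BilinForm ℚ V) (c : R) (g : GLPoints R V) : Prop :=
  ∀ v w : R ⊗[ℚ] V,
    ψ.baseChange R ((g : Module.End R (R ⊗[ℚ] V)) v) ((g : Module.End R (R ⊗[ℚ] V)) w)
      = c * ψ.baseChange R v w

variable {ψ : LinearMap.BilinForm ℚ V}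

theorem mem_iso_iff_isSimilitude_one {g : GLPoints R V} : g ∈ iso R ψ ↔ IsSimilitude ψ 1 g :=
  forall₂_congr fun v w => by rw [one_mul]

theorem IsSimilitude.mul {c d : R} {g g' : GLPoints R V} (h : IsSimilitude ψ c g)
    (h' : IsSimilitude ψ d g') : IsSimilitude ψ (c * d) (g * g') := fun v w => by
  rw [mul_assoc, ← h' v w]
  exact h _ _

theorem IsSimilitude.inv {c : Rˣ} {g : GLPoints R V} (h : IsSimilitude ψ (c : R) g) :
    IsSimilitude ψ ((c⁻¹ : Rˣ) : R) g⁻¹ := fun v w => by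
  have := h (((g⁻¹ : GLPoints R V) : Module.End R (R ⊗[ℚ] V)) v)
    (((g⁻¹ : GLPoints R V) : Module.End R (R ⊗[ℚ] V)) w)
  have hg : ∀ v, (g : Module.End R (R ⊗[ℚ] V))
      (((g⁻¹ : GLPoints R V) : Module.End R (R ⊗[ℚ] V)) v) = v := fun v =>
    LinearMap.congr_fun (g.mul_inv) v
  rw [hg, hg] at this
  rw [this, Units.inv_mul_cancel_left]

theorem isSimilitude_homothety {Ω : Type*} [Field Ω] [Algebra ℚ Ω] (t : Ωˣ) :
    IsSimilitude ψ ((t : Ω) ^ 2) (homothety Ω V t) := fun v w => by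
  simp [homothety, pow_two, mul_assoc]

/-- The group of similitudes of `ψ`. -/
def gIsoSubgroup (R : Type*) [CommRing R] [Algebra ℚ R] (ψ : LinearMap.BilinForm ℚ V) :
    Subgroup (GLPoints R V) where
  carrier := gIso R ψ
  one_mem' := ⟨1, fun v w => by simp⟩
  mul_mem' := by
    rintro g g' ⟨c, h⟩ ⟨d, h'⟩
    exact ⟨c * d, IsSimilitude.mul h h'⟩
  inv_mem' := by
    rintro g ⟨c, h⟩
    exact ⟨c⁻¹, IsSimilitude.inv h⟩

/-- The centralizer of `D` in `GL_V`. -/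
def centralizerPoints (R : Type*) [CommRing R] [Algebra ℚ R]
    (D : Subalgebra ℚ (Module.End ℚ V)) : Subgroup (GLPoints R V) where
  carrier := {g | ∀ β ∈ D, Commute (g : Module.End R (R ⊗[ℚ] V)) (LinearMap.baseChange R β)}
  one_mem' _ _ := Commute.one_left _
  mul_mem' hg hg' β hβ := (hg β hβ).mul_left (hg' β hβ)
  inv_mem' hg β hβ := (hg β hβ).units_inv_left

variable {D : Subalgebra ℚ (Module.End ℚ V)}

theorem homothety_mem_centralizerPoints {Ω : Type*} [Field Ω] [Algebra ℚ Ω] (t : Ωˣ) :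
    homothety Ω V t ∈ centralizerPoints Ω D := fun _ _ => Algebra.commute_algebraMap_left _ _

/-- Isometries commuting with `D`: the group whose identity component is the Lefschetz group. -/
def isoCentralizer (R : Type*) [CommRing R] [Algebra ℚ R] (ψ : LinearMap.BilinForm ℚ V)
    (D : Subalgebra ℚ (Module.End ℚ V)) : Set (GLPoints R V) :=
  iso R ψ ∩ centralizerPoints R D

theorem inv_mem_isoCentralizer {g : GLPoints R V} (hg : g ∈ isoCentralizer R ψ D) :
    g⁻¹ ∈ isoCentralizer R ψ D := by
  refine ⟨mem_iso_iff_isSimilitude_one.2 ?_, inv_mem hg.2⟩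
  have h : IsSimilitude ψ ((1 : Rˣ) : R) g := mem_iso_iff_isSimilitude_one.1 hg.1
  simpa only [inv_one, Units.val_one] using h.inv

/-- A similitude commuting with `D` is a homothety times an isometry commuting with `D`. -/
theorem exists_homothety_mul_of_isSimilitude {Ω : Type*} [Field Ω] [IsAlgClosed Ω] [Algebra ℚ Ω]
    {g : GLPoints Ω V} {c : Ωˣ} (hg : IsSimilitude ψ (c : Ω) g) (hD : g ∈ centralizerPoints Ω D) :
    ∃ t : Ωˣ, t ^ 2 = c ∧ ∃ u ∈ isoCentralizer Ω ψ D, g = homothety Ω V t * u := by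
  obtain ⟨t, ht⟩ := IsAlgClosed.exists_pow_nat_eq (c : Ω) two_pos
  have ht0 : t ≠ 0 := by
    rintro rfl
    exact c.ne_zero (by rw [← ht, zero_pow two_ne_zero])
  have ht' : Units.mk0 t ht0 ^ 2 = c := Units.ext ht
  refine ⟨Units.mk0 t ht0, ht', (homothety Ω V (Units.mk0 t ht0))⁻¹ * g, ⟨?_, ?_⟩,
    (mul_inv_cancel_left _ _).symm⟩
  · have h1 : IsSimilitude ψ ((c : Ωˣ) : Ω) (homothety Ω V (Units.mk0 t ht0)) := by
      rw [← ht', Units.val_pow_eq_pow_val]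
      exact isSimilitude_homothety _
    rw [mem_iso_iff_isSimilitude_one]
    simpa using h1.inv.mul hg
  · exact mul_mem (inv_mem (homothety_mem_centralizerPoints _)) hD

variable [FiniteDimensional ℚ V]

theorem apply_baseChange_finBasis (g : GLPoints R V) (i : Fin (Module.finrank ℚ V)) :
    (g : Module.End R (R ⊗[ℚ] V)) ((Module.finBasis ℚ V).baseChange R i) =
      ∑ a, entries g (a, i) • (Module.finBasis ℚ V).baseChange R a := by
  simp only [entries, LinearMap.toMatrix_apply]
  exact (Module.Basis.sum_repr _ _).symm

/-- The Gram matrix of `ψ` after the substitution `g`. -/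
def gram (ψ : LinearMap.BilinForm ℚ V) (g : GLPoints R V) (i j : Fin (Module.finrank ℚ V)) : R :=
  ∑ a, ∑ b, entries g (a, i) * entries g (b, j) *
    algebraMap ℚ R (ψ (Module.finBasis ℚ V a) (Module.finBasis ℚ V b))

theorem baseChange_apply_finBasis (i j : Fin (Module.finrank ℚ V)) :
    ψ.baseChange R ((Module.finBasis ℚ V).baseChange R i) ((Module.finBasis ℚ V).baseChange R j) =
      algebraMap ℚ R (ψ (Module.finBasis ℚ V i) (Module.finBasis ℚ V j)) := by
  simp [LinearMap.BilinForm.baseChange_tmul, Algebra.smul_def]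

theorem baseChange_apply_apply_finBasis (g : GLPoints R V) (i j : Fin (Module.finrank ℚ V)) :
    ψ.baseChange R ((g : Module.End R (R ⊗[ℚ] V)) ((Module.finBasis ℚ V).baseChange R i))
      ((g : Module.End R (R ⊗[ℚ] V)) ((Module.finBasis ℚ V).baseChange R j)) = gram ψ g i j := by
  simp only [apply_baseChange_finBasis, map_sum, LinearMap.sum_apply, map_smul,
    LinearMap.smul_apply, baseChange_apply_finBasis, smul_eq_mul, gram, mul_assoc, Finset.mul_sum]
  rw [Finset.sum_comm]
  exact Finset.sum_congr rfl fun _ _ => Finset.sum_congr rfl fun _ _ => mul_left_comm _ _ _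

theorem isSimilitude_iff {c : R} {g : GLPoints R V} : IsSimilitude ψ c g ↔ ∀ i j,
    gram ψ g i j = c * algebraMap ℚ R (ψ (Module.finBasis ℚ V i) (Module.finBasis ℚ V j)) := by
  simp only [← baseChange_apply_finBasis, ← baseChange_apply_apply_finBasis]
  refine ⟨fun h i j => h _ _, fun h v w => ?_⟩
  let b := (Module.finBasis ℚ V).baseChange R
  let B : LinearMap.BilinForm R (R ⊗[ℚ] V) := ψ.baseChange R
  have : B.compl₁₂ (g : Module.End R (R ⊗[ℚ] V)) (g : Module.End R (R ⊗[ℚ] V)) = c • B :=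
    LinearMap.ext_basis b b h
  exact LinearMap.congr_fun₂ this v w

theorem gram_mapPoints (φ : R →+* S) (g : GLPoints R V) (i j : Fin (Module.finrank ℚ V)) :
    gram ψ (mapPoints φ g) i j = φ (gram ψ g i j) := by
  simp [gram, entries_mapPoints, map_sum]

theorem IsSimilitude.mapPoints {c : R} {g : GLPoints R V} (h : IsSimilitude ψ c g) (φ : R →+* S) :
    IsSimilitude ψ (φ c) (mapPoints φ g) := by
  rw [isSimilitude_iff] at h ⊢
  intro i j
  rw [gram_mapPoints, h, map_mul]
  simp

theorem mapPoints_mem_gIso {g : GLPoints R V} (hg : g ∈ gIso R ψ) (φ : R →+* S) :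
    mapPoints φ g ∈ gIso S ψ := by
  obtain ⟨c, hc⟩ := hg
  exact ⟨Units.map (φ : R →* S) c, IsSimilitude.mapPoints hc φ⟩

/-- The polynomials computing the Gram matrix. -/
def gramPoly (ψ : LinearMap.BilinForm ℚ V) (i j : Fin (Module.finrank ℚ V)) : EntryPoly ℚ V :=
  ∑ a, ∑ b, MvPolynomial.X (a, i) * MvPolynomial.X (b, j) *
    MvPolynomial.C (ψ (Module.finBasis ℚ V a) (Module.finBasis ℚ V b))

theorem evalAt_gramPoly (g : GLPoints R V) (i j : Fin (Module.finrank ℚ V)) :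
    evalAt (gramPoly ψ i j) g = gram ψ g i j := by
  simp [evalAt, gramPoly, gram]

/-- The unknown multiplier is eliminated: proportionality of the transformed Gram matrix to the
original one is the vanishing of `2 × 2` minors. -/
theorem isAlgebraicOver_gIso (Ω : Type*) [Field Ω] [Algebra ℚ Ω]
    (ψ : LinearMap.BilinForm ℚ V) : IsAlgebraicOver ℚ (gIso Ω ψ) := by
  let A : Fin (Module.finrank ℚ V) → Fin (Module.finrank ℚ V) → ℚ := fun i j =>
    ψ (Module.finBasis ℚ V i) (Module.finBasis ℚ V j)
  refine ⟨Set.range fun q : (Fin (Module.finrank ℚ V) × Fin (Module.finrank ℚ V)) ×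
      (Fin (Module.finrank ℚ V) × Fin (Module.finrank ℚ V)) =>
    gramPoly ψ q.1.1 q.1.2 * MvPolynomial.C (A q.2.1 q.2.2) -
      gramPoly ψ q.2.1 q.2.2 * MvPolynomial.C (A q.1.1 q.1.2), Set.ext fun g => ?_⟩
  have heval : (g ∈ {g : GLPoints Ω V | ∀ f ∈ Set.range fun q : (Fin (Module.finrank ℚ V) ×
        Fin (Module.finrank ℚ V)) × (Fin (Module.finrank ℚ V) × Fin (Module.finrank ℚ V)) =>
        gramPoly ψ q.1.1 q.1.2 * MvPolynomial.C (A q.2.1 q.2.2) -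
        gramPoly ψ q.2.1 q.2.2 * MvPolynomial.C (A q.1.1 q.1.2), evalAt f g = 0}) ↔
      ∀ i j i' j', gram ψ g i j * algebraMap ℚ Ω (A i' j') =
        gram ψ g i' j' * algebraMap ℚ Ω (A i j) := by
    simp only [Set.mem_ofPred_eq, Set.forall_mem_range, Prod.forall, ← evalAt_gramPoly]
    simp only [evalAt, map_sub, map_mul, MvPolynomial.aeval_C, sub_eq_zero]
  rw [heval]
  constructor
  · rintro ⟨c, hc⟩ i j i' j'
    have h := isSimilitude_iff.1 (show IsSimilitude ψ (c : Ω) g from hc)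
    rw [h, h]
    ring
  · intro h
    by_cases h0 : ∃ i j, A i j ≠ 0
    · obtain ⟨i, j, hij⟩ := h0
      have hij' : algebraMap ℚ Ω (A i j) ≠ 0 :=
        (map_ne_zero _).2 hij
      have hs : IsSimilitude ψ (gram ψ g i j / algebraMap ℚ Ω (A i j)) g := by
        refine isSimilitude_iff.2 fun i' j' => ?_
        have := h i' j' i j
        change _ = _ * algebraMap ℚ Ω (A i' j')
        field_simp
        exact this
      -- A zero multiplier would force `ψ = 0`, since `g` is surjective.
      refine ⟨Units.mk0 _ fun hc => hij' ?_, hs⟩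
      rw [hc] at hs
      have hg : ∀ v, (g : Module.End Ω (Ω ⊗[ℚ] V))
          (((g⁻¹ : GLPoints Ω V) : Module.End Ω (Ω ⊗[ℚ] V)) v) = v := fun v =>
        LinearMap.congr_fun (g.mul_inv) v
      rw [← baseChange_apply_finBasis (ψ := ψ), ← hg ((Module.finBasis ℚ V).baseChange Ω i),
        ← hg ((Module.finBasis ℚ V).baseChange Ω j), hs, zero_mul]
    -- Here `ψ = 0`, and any multiplier works.
    · push Not at h0
      refine ⟨1, isSimilitude_iff.2 fun i j => ?_⟩
      have h0' : ∀ i j, ψ (Module.finBasis ℚ V i) (Module.finBasis ℚ V j) = 0 := h0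
      simp [gram, h0']

/-- In coordinates the condition is linear with rational coefficients; both its functoriality in `R`
and its algebraicity over `ℚ` are read off from this form. -/
theorem commute_baseChange_iff {g : GLPoints R V} {β : Module.End ℚ V} :
    Commute (g : Module.End R (R ⊗[ℚ] V)) (LinearMap.baseChange R β) ↔
      ∀ i j, ∑ m, entries g (i, m) * algebraMap ℚ R (LinearMap.toMatrix (Module.finBasis ℚ V)
          (Module.finBasis ℚ V) β m j) =
        ∑ m, algebraMap ℚ R (LinearMap.toMatrix (Module.finBasis ℚ V) (Module.finBasis ℚ V) β i m) *
          entries g (m, j) := by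
  let b := (Module.finBasis ℚ V).baseChange R
  have hβ : LinearMap.toMatrix b b (LinearMap.baseChange R β) =
      (LinearMap.toMatrix (Module.finBasis ℚ V) (Module.finBasis ℚ V) β).map (algebraMap ℚ R) := by
    ext i j
    simp [b, LinearMap.toMatrix_apply, Algebra.algebraMap_eq_smul_one]
  rw [Commute, SemiconjBy, ← (LinearMap.toMatrix b b).injective.eq_iff, LinearMap.toMatrix_mul,
    LinearMap.toMatrix_mul, hβ, ← Matrix.ext_iff]
  rfl

theorem mapPoints_mem_centralizerPoints {g : GLPoints R V} (hg : g ∈ centralizerPoints R D)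
    (φ : R →+* S) : mapPoints φ g ∈ centralizerPoints S D := by
  intro β hβ
  have h := commute_baseChange_iff.1 (hg β hβ)
  refine commute_baseChange_iff.2 fun i j => ?_
  simpa [entries_mapPoints, map_sum] using congrArg φ (h i j)

theorem isAlgebraicOver_centralizerPoints (R : Type*) [CommRing R] [Algebra ℚ R]
    (D : Subalgebra ℚ (Module.End ℚ V)) :
    IsAlgebraicOver ℚ (centralizerPoints R D : Set (GLPoints R V)) := by
  have : (centralizerPoints R D : Set (GLPoints R V)) = ⋂ β : D, {g : GLPoints R V | Commute
      (g : Module.End R (R ⊗[ℚ] V)) (LinearMap.baseChange R (β : Module.End ℚ V))} := by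
    ext g
    simp [centralizerPoints]
  rw [this]
  refine isAlgebraicOver_iInter fun β => ?_
  refine ⟨Set.range fun ij : Fin (Module.finrank ℚ V) × Fin (Module.finrank ℚ V) =>
    ∑ m, MvPolynomial.X (ij.1, m) * MvPolynomial.C (LinearMap.toMatrix (Module.finBasis ℚ V)
      (Module.finBasis ℚ V) (β : Module.End ℚ V) m ij.2) -
    ∑ m, MvPolynomial.C (LinearMap.toMatrix (Module.finBasis ℚ V) (Module.finBasis ℚ V)
      (β : Module.End ℚ V) ij.1 m) * MvPolynomial.X (m, ij.2), Set.ext fun g => ?_⟩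
  simp only [Set.mem_ofPred_eq, Set.forall_mem_range, Prod.forall, commute_baseChange_iff]
  simp [evalAt, sub_eq_zero]

theorem mapPoints_mem_isoCentralizer {g : GLPoints R V} (hg : g ∈ isoCentralizer R ψ D)
    (φ : R →+* S) : mapPoints φ g ∈ isoCentralizer S ψ D := by
  refine ⟨mem_iso_iff_isSimilitude_one.2 ?_, mapPoints_mem_centralizerPoints hg.2 φ⟩
  simpa using (mem_iso_iff_isSimilitude_one.1 hg.1).mapPoints φ

end Similitudes

attribute [local instance] zariskiTopology

/-! ### The Mumford-Tate group -/

section Algebraic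

variable {V : Type*} [AddCommGroup V] [Module ℚ V] [FiniteDimensional ℚ V]

theorem IsAlgebraicOver.isClosed {k Ω : Type*} [CommRing k] [Field Ω] [Algebra ℚ Ω] [Algebra k Ω]
    {X : Set (GLPoints Ω V)} (hX : IsAlgebraicOver k X) : IsClosed X := by
  rw [← closure_subset_iff_isClosed, closure_eq_zariskiClosure]
  intro g hg
  rw [← zariskiClosure_eq_of_isAlgebraicOver hX]
  intro f hf
  have := hg (MvPolynomial.map (algebraMap k Ω) f) fun x hx => by
    rw [evalAt, MvPolynomial.aeval_map_algebraMap]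
    exact hf x hx
  rwa [evalAt, MvPolynomial.aeval_map_algebraMap] at this

end Algebraic

namespace HodgeStructure

variable {V : Type*} [AddCommGroup V] [Module ℚ V] {n : ℤ} (h : HodgeStructure V n)

theorem induction_comp {P : ℂ ⊗[ℚ] V → Prop} (hcomp : ∀ p, ∀ x ∈ h.comp p, P x)
    (hadd : ∀ x y, P x → P y → P (x + y)) (x : ℂ ⊗[ℚ] V) : P x := by
  have hx : x ∈ ⨆ p, h.comp p := by
    rw [h.isInternal.submodule_iSup_eq_top]
    trivial
  exact Submodule.iSup_induction h.comp (motive := P) hx hcomp (hcomp 0 0 (zero_mem _)) hadd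

theorem cocharacter_one : h.cocharacter 1 = 1 := by
  refine Units.ext (LinearMap.ext fun x => ?_)
  induction x using h.induction_comp with
  | hcomp p x hx => simp [h.cocharacter_apply 1 p x hx]
  | hadd x y hx hy => rw [map_add, map_add, hx, hy]

theorem isSimilitude_cocharacter {ψ : LinearMap.BilinForm ℚ V} (hψ : h.IsPolarization ψ) (z : ℂˣ) :
    IsSimilitude ψ ((z : ℂ) ^ (-n)) (h.cocharacter z) := by
  intro v w
  induction v using h.induction_comp with
  | hadd v v' hv hv' => simp only [map_add, LinearMap.add_apply, hv, hv', mul_add]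
  | hcomp p v hv =>
    induction w using h.induction_comp with
    | hadd w w' hw hw' => simp only [map_add, hw, hw', mul_add]
    | hcomp p' w hw =>
      rw [h.cocharacter_apply z p v hv, h.cocharacter_apply z p' w hw]
      by_cases hp : p + p' = n
      · simp only [map_smul, LinearMap.smul_apply, smul_eq_mul, ← mul_assoc]
        rw [← zpow_add₀ z.ne_zero, ← hp]
        congr 2
        ring
      · simp [hψ.orthogonal p p' hp v hv w hw]

theorem cocharacter_mem_gIso {ψ : LinearMap.BilinForm ℚ V} (hψ : h.IsPolarization ψ) (z : ℂˣ) :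
    h.cocharacter z ∈ gIso ℂ ψ :=
  ⟨z ^ (-n), fun v w => by
    rw [h.isSimilitude_cocharacter hψ z v w, Units.val_zpow_eq_zpow_val]⟩

theorem cocharacter_mem_centralizerPoints {D : Subalgebra ℚ (Module.End ℚ V)}
    (hD : h.PreservedBy D) (z : ℂˣ) : h.cocharacter z ∈ centralizerPoints ℂ D := by
  intro β hβ
  refine LinearMap.ext fun x => ?_
  rw [Module.End.mul_apply, Module.End.mul_apply]
  induction x using h.induction_comp with
  | hadd x y hx hy => simp only [map_add, hx, hy]
  | hcomp p x hx =>
    rw [h.cocharacter_apply z p x hx, h.cocharacter_apply z p _ (hD β hβ p x hx), map_smul]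

variable [FiniteDimensional ℚ V]

theorem entries_cocharacter_mem_laurentFunctions
    (ij : Fin (Module.finrank ℚ V) × Fin (Module.finrank ℚ V)) :
    (fun z => entries (h.cocharacter z) ij) ∈ laurentFunctions ℂ := by
  let b := (Module.finBasis ℚ V).baseChange ℂ
  suffices H : ∀ x : ℂ ⊗[ℚ] V, (fun z => b.repr
      ((h.cocharacter z : Module.End ℂ (ℂ ⊗[ℚ] V)) x) ij.1) ∈ laurentFunctions ℂ by
    convert H (b ij.2) using 2
    simp only [entries, LinearMap.toMatrix_apply, b]
  intro x
  induction x using h.induction_comp with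
  | hadd x y hx hy =>
    convert add_mem hx hy using 1
    funext z
    simp
  | hcomp p x hx =>
    have : (fun z : ℂˣ => b.repr ((h.cocharacter z : Module.End ℂ (ℂ ⊗[ℚ] V)) x) ij.1) =
        (fun z : ℂˣ => (z : ℂ) ^ (-p)) * algebraMap ℂ (ℂˣ → ℂ) (b.repr x ij.1) := by
      funext z
      rw [h.cocharacter_apply z p x hx, Pi.mul_apply, Pi.algebraMap_apply]
      simp
    rw [this]
    exact mul_mem (zpow_mem_laurentFunctions _) (Subalgebra.algebraMap_mem _ _)

variable {ψ : LinearMap.BilinForm ℚ V}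

theorem isAlgebraicOver_mumfordTate :
    IsAlgebraicOver ℚ (h.mumfordTate ψ : Set (GLPoints ℂ V)) := by
  rw [mumfordTate, Subgroup.coe_sInf]
  exact isAlgebraicOver_iInter fun M => isAlgebraicOver_iInter fun hM => hM.1

theorem cocharacter_mem_mumfordTate (z : ℂˣ) : h.cocharacter z ∈ h.mumfordTate ψ :=
  Subgroup.mem_sInf.2 fun _ hM => hM.2.2 z

theorem mumfordTate_le {M : Subgroup (GLPoints ℂ V)}
    (h1 : IsAlgebraicOver ℚ (M : Set (GLPoints ℂ V))) (h2 : (M : Set (GLPoints ℂ V)) ⊆ gIso ℂ ψ)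
    (h3 : ∀ z : ℂˣ, h.cocharacter z ∈ M) : h.mumfordTate ψ ≤ M :=
  sInf_le ⟨h1, h2, h3⟩

theorem mumfordTate_le_gIsoSubgroup (hψ : h.IsPolarization ψ) :
    h.mumfordTate ψ ≤ gIsoSubgroup ℂ ψ :=
  h.mumfordTate_le (isAlgebraicOver_gIso ℂ ψ) subset_rfl (h.cocharacter_mem_gIso hψ)

theorem mumfordTate_le_centralizerPoints (hψ : h.IsPolarization ψ)
    {D : Subalgebra ℚ (Module.End ℚ V)} (hD : h.PreservedBy D) :
    h.mumfordTate ψ ≤ centralizerPoints ℂ D :=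
  (h.mumfordTate_le (M := gIsoSubgroup ℂ ψ ⊓ centralizerPoints ℂ D)
    ((isAlgebraicOver_gIso ℂ ψ).inter (isAlgebraicOver_centralizerPoints ℂ D))
    Set.inter_subset_left fun z => ⟨h.cocharacter_mem_gIso hψ z,
      h.cocharacter_mem_centralizerPoints hD z⟩).trans inf_le_right

theorem mapPoints_mem_mumfordTate (σ : ℂ ≃+* ℂ) {g : GLPoints ℂ V} (hg : g ∈ h.mumfordTate ψ) :
    mapPoints (σ : ℂ →+* ℂ) g ∈ h.mumfordTate ψ := by
  rw [← SetLike.mem_coe, ← zariskiClosure_eq_of_isAlgebraicOver h.isAlgebraicOver_mumfordTate]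
  exact mapPoints_mem_zariskiClosure_rat _ (subset_zariskiClosure _ hg)

/-- The Mumford-Tate group is connected. -/
theorem isPreconnected_mumfordTate (hψ : h.IsPolarization ψ) :
    IsPreconnected (h.mumfordTate ψ : Set (GLPoints ℂ V)) := by
  have hle : h.mumfordTate ψ ≤ identityComponentSubgroup (h.mumfordTate ψ) := by
    refine h.mumfordTate_le ?_ ?_ ?_
    -- The identity component competes in the minimality of `MT`: automorphisms of `ℂ` permute the
    -- points of `MT` continuously and fix `1`, so they preserve its component.
    · refine isAlgebraicOver_rat_of_forall_ringEquiv (isClosed_identityComponent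
        (h.mumfordTate ψ).one_mem h.isAlgebraicOver_mumfordTate.isClosed) fun σ x hx => ?_
      exact mapPoints_mem_identityComponent σ (h.mumfordTate ψ).one_mem
        (fun x hx => h.mapPoints_mem_mumfordTate σ (identityComponent_subset _ hx)) hx
    · exact (identityComponent_subset _).trans (h.mumfordTate_le_gIsoSubgroup hψ)
    · intro z
      -- The image of `μ_∞` is connected and passes through `1`.
      refine subset_identityComponent (isPreconnected_range_of_laurent
        h.entries_cocharacter_mem_laurentFunctions) ⟨1, h.cocharacter_one⟩ ?_ ⟨z, rfl⟩
      rintro _ ⟨z, rfl⟩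
      exact h.cocharacter_mem_mumfordTate z
  rw [(identityComponent_subset _).antisymm' hle]
  exact isPreconnected_identityComponent _

theorem hodgeGroup_subset_lefschetz (hψ : h.IsPolarization ψ) {D : Subalgebra ℚ (Module.End ℚ V)}
    (hD : h.PreservedBy D) : h.hodgeGroup ψ ⊆ lefschetz ψ D :=
  identityComponent_mono fun _ hg => ⟨hg.2, h.mumfordTate_le_centralizerPoints hψ hD hg.1⟩

end HodgeStructure

/-! ### The algebraic monodromy group -/

section Monodromy

variable {V : Type*} [AddCommGroup V] [Module ℚ V] {l : ℕ} [Fact l.Prime] {Γ : Type*} [Group Γ]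

/-- This is the twist by `τ = 1`. -/
theorem isoCentralizer_subset_decomposableLefschetz (ψ : LinearMap.BilinForm ℚ V)
    (D : Subalgebra ℚ (Module.End ℚ V)) (ρe : Γ →* (D ≃ₐ[ℚ] D)) :
    isoCentralizer ℂ ψ D ⊆ decomposableLefschetz ψ D ρe := by
  intro g hg
  refine Set.mem_iUnion.2 ⟨1, hg.1, fun β => ?_⟩
  rw [map_one, (hg.2 β β.2).eq, Units.mul_inv_cancel_right]
  rfl

theorem IsEndEquivariant.mem_centralizerPoints {D : Subalgebra ℚ (Module.End ℚ V)}
    {ρe : Γ →* (D ≃ₐ[ℚ] D)} {ρ : Γ →* GLPoints ℚ_[l] V} (h : IsEndEquivariant D ρe ρ) {σ : Γ}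
    (hσ : σ ∈ ρe.ker) : ρ σ ∈ centralizerPoints ℚ_[l] D := by
  intro β hβ
  refine LinearMap.ext fun v => ?_
  have := h σ ⟨β, hβ⟩ v
  rwa [MonoidHom.mem_ker.1 hσ] at this

variable [FiniteDimensional ℚ V]

/-- Any abstract isomorphism computes the base change, because the equations are rational. -/
theorem baseChangePadic_eq_image (ι : ℂ ≃+* AlgebraicClosure ℚ_[l]) {X : Set (GLPoints ℂ V)}
    (hX : IsAlgebraicOver ℚ X) :
    baseChangePadic l X = mapPoints (ι : ℂ →+* AlgebraicClosure ℚ_[l]) '' X := by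
  ext g
  constructor
  · intro hg
    refine ⟨mapPoints (ι.symm : AlgebraicClosure ℚ_[l] →+* ℂ) g, ?_, mapPoints_symm_apply ι g⟩
    refine mem_of_mapPoints_mem_zariskiClosure_rat (φ := (ι : ℂ →+* AlgebraicClosure ℚ_[l]))
      ι.injective hX ?_
    rwa [mapPoints_symm_apply]
  · rintro ⟨x, hx, rfl⟩
    exact mapPoints_mem_zariskiClosure_rat _ (subset_zariskiClosure _ hx)

theorem algMonodromy_eq_closure (ρ : Γ →* GLPoints ℚ_[l] V) :
    algMonodromy ρ =
      closure (mapPoints (algebraMap ℚ_[l] (AlgebraicClosure ℚ_[l])) '' Set.range ρ) :=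
  zariskiClosure_eq_closure_image _

theorem mul_mem_algMonodromy {ρ : Γ →* GLPoints ℚ_[l] V} {x y : GLPoints (AlgebraicClosure ℚ_[l]) V}
    (hx : x ∈ algMonodromy ρ) (hy : y ∈ algMonodromy ρ) : x * y ∈ algMonodromy ρ := by
  rw [algMonodromy_eq_closure] at *
  refine mul_mem_closure_of_mul_mem ?_ hx hy
  rintro _ ⟨_, ⟨σ, rfl⟩, rfl⟩ _ ⟨_, ⟨τ, rfl⟩, rfl⟩
  exact ⟨ρ (σ * τ), ⟨_, rfl⟩, by rw [map_mul, map_mul]⟩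

theorem isClosed_algMonodromy (ρ : Γ →* GLPoints ℚ_[l] V) : IsClosed (algMonodromy ρ) := by
  rw [algMonodromy_eq_closure]
  exact isClosed_closure

theorem mapPoints_mem_algMonodromy (ρ : Γ →* GLPoints ℚ_[l] V) (σ : Γ) :
    mapPoints (algebraMap ℚ_[l] (AlgebraicClosure ℚ_[l])) (ρ σ) ∈ algMonodromy ρ := by
  rw [algMonodromy_eq_closure]
  exact subset_closure ⟨_, ⟨σ, rfl⟩, rfl⟩

/-- The Sato–Tate hypothesis enters the proof here. Points are moved to `ℂ`, where the decomposable
Lefschetz group is defined, and back. -/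
theorem isoCentralizer_subset_algMonodromy {ψ : LinearMap.BilinForm ℚ V}
    {D : Subalgebra ℚ (Module.End ℚ V)} {ρe : Γ →* (D ≃ₐ[ℚ] D)} {ρ : Γ →* GLPoints ℚ_[l] V}
    (hDL : algMonodromyOne ψ ρ = baseChangePadic l (decomposableLefschetz ψ D ρe)) :
    isoCentralizer (AlgebraicClosure ℚ_[l]) ψ D ⊆ algMonodromy ρ := by
  intro g hg
  obtain ⟨ι⟩ := nonempty_complex_ringEquiv l
  have hg' := mapPoints_mem_isoCentralizer hg (ι.symm : AlgebraicClosure ℚ_[l] →+* ℂ)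
  have := mapPoints_mem_zariskiClosure_rat (ι : ℂ →+* AlgebraicClosure ℚ_[l])
    (subset_zariskiClosure (k := ℚ) _ (isoCentralizer_subset_decomposableLefschetz ψ D ρe hg'))
  rw [mapPoints_symm_apply] at this
  exact (hDL.symm.subset this).1

/-- Transported to the `l`-adic side, the Lefschetz group is connected inside the monodromy group,
so the inclusion of identity components in `MT` applies to it. -/
theorem lefschetz_subset_mumfordTate {n : ℤ} {h : HodgeStructure V n}
    {ψ : LinearMap.BilinForm ℚ V} {D : Subalgebra ℚ (Module.End ℚ V)}
    {ρe : Γ →* (D ≃ₐ[ℚ] D)} {ρ : Γ →* GLPoints ℚ_[l] V}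
    (hDL : algMonodromyOne ψ ρ = baseChangePadic l (decomposableLefschetz ψ D ρe))
    (hMT : identityComponent (algMonodromy ρ) ⊆ baseChangePadic l (h.mumfordTate ψ)) :
    lefschetz ψ D ⊆ h.mumfordTate ψ := by
  intro g hg
  obtain ⟨ι⟩ := nonempty_complex_ringEquiv l
  refine mem_of_mapPoints_mem_zariskiClosure_rat (φ := (ι : ℂ →+* AlgebraicClosure ℚ_[l]))
    ι.injective h.isAlgebraicOver_mumfordTate (hMT ?_)
  refine mapPoints_mem_identityComponent ι ?_ (fun x hx => ?_) hg
  · exact ⟨fun v w => rfl, fun β _ => (Commute.one_left _).eq⟩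
  · exact isoCentralizer_subset_algMonodromy hDL
      (mapPoints_mem_isoCentralizer (identityComponent_subset _ hx) _)

variable {K Kbar : Type*} [Field K] [NumberField K] [Field Kbar] [Algebra K Kbar]
  [IsAlgClosure K Kbar] {n : ℤ} {ψ : LinearMap.BilinForm ℚ V} {D : Subalgebra ℚ (Module.End ℚ V)}
  {ρe : Gal(Kbar/K) →* (D ≃ₐ[ℚ] D)} {ρ : Gal(Kbar/K) →* GLPoints ℚ_[l] V}

/-- The algebraic monodromy group contains the homotheties, because the cyclotomic character has
infinite image on every open subgroup. -/
theorem homothety_mem_algMonodromy (hn : n ≠ 0) (hρe : IsOpen (ρe.ker : Set Gal(Kbar/K)))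
    (hρψ : IsFormEquivariant n ψ ρ) (hρD : IsEndEquivariant D ρe ρ)
    (hDL : algMonodromyOne ψ ρ = baseChangePadic l (decomposableLefschetz ψ D ρe))
    (t : (AlgebraicClosure ℚ_[l])ˣ) :
    homothety (AlgebraicClosure ℚ_[l]) V t ∈ algMonodromy ρ := by
  refine mem_of_infinite_of_laurent entries_homothety_mem_laurentFunctions
    (isClosed_algMonodromy ρ) (fun hfin => ?_) t
  let j : ℤ_[l] →+* AlgebraicClosure ℚ_[l] :=
    (algebraMap ℚ_[l] (AlgebraicClosure ℚ_[l])).comp PadicInt.Coe.ringHom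
  have hj : Function.Injective (Units.map (j : ℤ_[l] →* AlgebraicClosure ℚ_[l])) :=
    Units.map_injective ((algebraMap ℚ_[l] _).injective.comp Subtype.coe_injective)
  -- The squares of the `t` whose homothety lies in the group include all `χ_c(σ)^(-n)` with `σ ∈
  -- ker ρe`, so there cannot be finitely many such `t`.
  refine infinite_cyclotomicCharacter_zpow l hρe (neg_ne_zero.2 hn)
    (Set.Finite.of_finite_image ((hfin.image fun t => t ^ 2).subset ?_) hj.injOn)
  rintro _ ⟨_, ⟨σ, hσ, rfl⟩, rfl⟩
  have hs : IsSimilitude ψ ((Units.map (j : ℤ_[l] →* AlgebraicClosure ℚ_[l])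
      (cyclotomicCharacter Kbar l σ.toRingEquiv ^ (-n)) : (AlgebraicClosure ℚ_[l])ˣ) :
      AlgebraicClosure ℚ_[l])
      (mapPoints (algebraMap ℚ_[l] (AlgebraicClosure ℚ_[l])) (ρ σ)) :=
    IsSimilitude.mapPoints (hρψ σ) _
  obtain ⟨t, ht, u, hu, hg⟩ := exists_homothety_mul_of_isSimilitude hs
    (mapPoints_mem_centralizerPoints (hρD.mem_centralizerPoints hσ) _)
  refine ⟨t, ?_, ht⟩
  -- Dividing `ρ σ = t u` by `u`, which lies in the monodromy group, leaves the homothety `t`.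
  have := mul_mem_algMonodromy (mapPoints_mem_algMonodromy ρ σ)
    (isoCentralizer_subset_algMonodromy hDL (inv_mem_isoCentralizer hu))
  rwa [hg, mul_inv_cancel_right] at this

variable {h : HodgeStructure V n}

/-- Each point of `MT` is a homothety times an isometry commuting with `D`, and the monodromy group
contains both factors; connectedness of `MT` does the rest. -/
theorem baseChangePadic_mumfordTate_subset (hn : n ≠ 0) (hψ : h.IsPolarization ψ)
    (hD : h.PreservedBy D) (hρe : IsOpen (ρe.ker : Set Gal(Kbar/K)))
    (hρψ : IsFormEquivariant n ψ ρ) (hρD : IsEndEquivariant D ρe ρ)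
    (hDL : algMonodromyOne ψ ρ = baseChangePadic l (decomposableLefschetz ψ D ρe)) :
    baseChangePadic l (h.mumfordTate ψ) ⊆ identityComponent (algMonodromy ρ) := by
  obtain ⟨ι⟩ := nonempty_complex_ringEquiv l
  rw [baseChangePadic_eq_image ι h.isAlgebraicOver_mumfordTate]
  refine subset_identityComponent ((h.isPreconnected_mumfordTate hψ).image _
    (continuous_mapPoints ι).continuousOn) ⟨1, one_mem _, map_one _⟩ ?_
  rintro _ ⟨g, hg, rfl⟩
  obtain ⟨c, hc⟩ := mapPoints_mem_gIso (h.mumfordTate_le_gIsoSubgroup hψ hg)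
    (ι : ℂ →+* AlgebraicClosure ℚ_[l])
  obtain ⟨t, -, u, hu, hg'⟩ := exists_homothety_mul_of_isSimilitude hc
    (mapPoints_mem_centralizerPoints (h.mumfordTate_le_centralizerPoints hψ hD hg) _)
  rw [hg']
  exact mul_mem_algMonodromy (homothety_mem_algMonodromy hn hρe hρψ hρD hDL t)
    (isoCentralizer_subset_algMonodromy hDL hu)

end Monodromy

end HodgeLadic

end

theorem mainTheorem11
    {K Kbar : Type*} [Field K] [NumberField K] [Field Kbar] [Algebra K Kbar] [IsAlgClosure K Kbar]
    {V : Type*} [AddCommGroup V] [Module ℚ V] [FiniteDimensional ℚ V]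
    {n : ℤ} (hn : Odd n)
    (h : HodgeStructure V n) (ψ : LinearMap.BilinForm ℚ V) (hψ : h.IsPolarization ψ)
    (D : Subalgebra ℚ (Module.End ℚ V)) (hD : h.PreservedBy D)
    (ρe : Gal(Kbar/K) →* (D ≃ₐ[ℚ] D)) (hρe : IsOpen (ρe.ker : Set Gal(Kbar/K)))
    (ρ : ∀ (l : ℕ) [Fact l.Prime], Gal(Kbar/K) →* GLPoints ℚ_[l] V)
    (hρ : ∀ (l : ℕ) [Fact l.Prime], IsContinuousRep (ρ l))
    (hρψ : ∀ (l : ℕ) [Fact l.Prime], IsFormEquivariant n ψ (ρ l))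
    (hρD : ∀ (l : ℕ) [Fact l.Prime], IsEndEquivariant D ρe (ρ l))
    (hDL : ∀ (l : ℕ) [Fact l.Prime],
      algMonodromyOne ψ (ρ l) = baseChangePadic l (decomposableLefschetz ψ D ρe))
    (hMT : ∀ (l : ℕ) [Fact l.Prime],
      identityComponent (algMonodromy (ρ l)) ⊆ baseChangePadic l (h.mumfordTate ψ)) :
    h.hodgeGroup ψ = lefschetz ψ D ∧
      ∀ (l : ℕ) [Fact l.Prime],
        identityComponent (algMonodromy (ρ l)) = baseChangePadic l (h.mumfordTate ψ) := by
  have hn0 : n ≠ 0 := by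
    rintro rfl
    exact Int.not_odd_zero hn
  refine ⟨(h.hodgeGroup_subset_lefschetz hψ hD).antisymm ?_, fun l _ => (hMT l).antisymm
    (baseChangePadic_mumfordTate_subset hn0 hψ hD hρe (hρψ l) (hρD l) (hDL l))⟩
  -- The first assertion does not involve `l`, so any single prime serves.
  have : Fact (Nat.Prime 2) := ⟨Nat.prime_two⟩
  have h1 : (1 : GLPoints ℂ V) ∈ isoCentralizer ℂ ψ D :=
    ⟨fun v w => rfl, fun β _ => (Commute.one_left _).eq⟩
  exact subset_identityComponent (isPreconnected_identityComponent _)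
    (one_mem_identityComponent h1) fun g hg =>
      ⟨lefschetz_subset_mumfordTate (hDL 2) (hMT 2) hg, (identityComponent_subset _ hg).1⟩
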